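/- Let $n\geqslant1$ and let $\Omega$ be a domain (nonempty, open, connected) in the space $\mathbb R\times\mathbb R^n\times\mathbb R_{>0}$ of the variables $(t,x,\rho)$. For a smooth function $S\colon\Omega\to\mathbb C$ consider the nonlinear Schrödinger equation $$\mathcal L_S\colon\quad i\psi_t+\sum_{a=1}^n\psi_{aa}+S(t,x,|\psi|)\,\psi=0,\qquad \psi=\psi(t,x)\in\mathbb C,$$ on the set $M_\Omega=\{(t,x,\psi)\in\mathbb R\times\mathbb R^n\times\mathbb C : (t,x,|\psi|)\in\Omega\}$. Let $\mathfrak g_S$ denote its maximal Lie invariance algebra, that is, the real vector space of all vector fields $$Q=\tau\partial_t+\sum_{a=1}^n\xi^a\partial_{x_a}+\eta\,\partial_\psi+\eta^*\partial_{\psi^*}$$ on $M_\Omega$, with smooth real-valued $\tau,\xi^a$ and smooth complex-valued $\eta$ depending on $(t,x,\psi,\psi^*)$, that satisfy the infinitesimal invariance criterion $$Q_{(2)}\Big(i\psi_t+\sum_{a=1}^n\psi_{aa}+S(t,x,|\psi|)\psi\Big)=0$$ at all points of the second-order jet space over $M_\Omega$ at which $i\psi_t+\sum_a\psi_{aa}+S(t,x,|\psi|)\psi=0$,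 where $Q_{(2)}$ is the second prolongation of $Q$. If $S_\rho\ne0$, in the sense that $S_\rho$ does not vanish identically on any nonempty open subset of $\Omega$ (in particular, if $S_\rho$ vanishes nowhere), then $\mathfrak g_S$ is finite-dimensional and $$\dim_{\mathbb R}\mathfrak g_S\leqslant\frac{n(n+3)}2+4.$$ This upper bound is the least possible: the function $S=\rho^{4/n}$ satisfies $S_\rho\ne0$, and $\dim_{\mathbb R}\mathfrak g_S=\frac{n(n+3)}2+4$ for it. -/

import Mathlib

open scoped ContDiff

noncomputable section

namespace NLS

/-- The space of the variables `(t, x, ψ)`: a point is `(z, ψ)` with `z 0 = t` and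
`z a.succ = x_a`. It is regarded as a real space, so that a real-smooth function on it is a smooth
function of `(t, x, ψ, ψ*)`. -/
abbrev Base (n : ℕ) : Type := (Fin (n + 1) → ℝ) × ℂ

/-- First-order jets `((z, ψ), (ψ_μ))`. -/
abbrev Jet1 (n : ℕ) : Type := Base n × (Fin (n + 1) → ℂ)

/-- Second-order jets `(((z, ψ), (ψ_μ)), (ψ_{μν}))`; the array `ψ_{μν}` of a genuine jet is
symmetric, which is required where jets are quantified over. -/
abbrev Jet2 (n : ℕ) : Type := Jet1 n × (Fin (n + 1) → Fin (n + 1) → ℂ)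

/-- The points `(z, ψ)` with `(z, |ψ|) ∈ Ω`. -/
def dom {n : ℕ} (Ω : Set ((Fin (n + 1) → ℝ) × ℝ)) : Set (Base n) :=
  {p | (p.1, ‖p.2‖) ∈ Ω}

/-- The derivative `S_ρ` of `S = S(z, ρ)`. -/
def derivRho {n : ℕ} (S : (Fin (n + 1) → ℝ) × ℝ → ℂ) (q : (Fin (n + 1) → ℝ) × ℝ) : ℂ :=
  deriv (fun r : ℝ => S (q.1, r)) q.2

/-- `Ω` is a domain (nonempty, open, connected) in the space of `(t, x, ρ)` with `ρ > 0`. -/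
structure IsDomainRho {n : ℕ} (Ω : Set ((Fin (n + 1) → ℝ) × ℝ)) : Prop where
  isOpen : IsOpen Ω
  isConnected : IsConnected Ω
  rho_pos : ∀ q ∈ Ω, 0 < q.2

/-- `S` is a smooth complex-valued function on `Ω` with `S_ρ ≠ 0`, in the sense that `S_ρ` does not
vanish identically on any nonempty open subset of `Ω`. -/
structure IsClassS {n : ℕ} (Ω : Set ((Fin (n + 1) → ℝ) × ℝ))
    (S : (Fin (n + 1) → ℝ) × ℝ → ℂ) : Prop where
  smooth : ContDiffOn ℝ ∞ S Ω
  derivRho_ne : ∀ U : Set ((Fin (n + 1) → ℝ) × ℝ), IsOpen U → U ⊆ Ω → U.Nonempty →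
    ∃ q ∈ U, derivRho S q ≠ 0

/-- Total derivative `D_μ f = f_μ + ψ_μ f_ψ + ψ*_μ f_{ψ*}` of a function of `(z, ψ, ψ*)`. -/
def totalDeriv1 {n : ℕ} {F : Type*} [NormedAddCommGroup F] [NormedSpace ℝ F]
    (μ : Fin (n + 1)) (f : Base n → F) (j : Jet1 n) : F :=
  fderiv ℝ f j.1 (Pi.single μ 1, j.2 μ)

/-- Total derivative `D_μ f` of a function on the first-order jet space. -/
def totalDeriv2 {n : ℕ} {F : Type*} [NormedAddCommGroup F] [NormedSpace ℝ F]
    (μ : Fin (n + 1)) (f : Jet1 n → F) (j : Jet2 n) : F :=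
  fderiv ℝ f j.1 ((Pi.single μ 1, j.1.2 μ), j.2 μ)

/-- First prolongation coefficient `η^μ = D_μ η - (D_μ ξ^ν) ψ_ν` of the vector field
`Q = ξ^ν ∂_ν + η ∂_ψ + η* ∂_{ψ*}` (with `ξ^0 = τ`), where `Q p = ((ξ^ν p)_ν, η p)`. -/
def prol1 {n : ℕ} (Q : Base n → Base n) (μ : Fin (n + 1)) (j : Jet1 n) : ℂ :=
  totalDeriv1 μ (fun p => (Q p).2) j
    - ∑ ν, totalDeriv1 μ (fun p => (Q p).1 ν) j • j.2 ν

/-- Second prolongation coefficient `η^{μν} = D_ν η^μ - (D_ν ξ^κ) ψ_{κμ}`. -/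
def prol2 {n : ℕ} (Q : Base n → Base n) (μ ν : Fin (n + 1)) (j : Jet2 n) : ℂ :=
  totalDeriv2 ν (prol1 Q μ) j
    - ∑ κ, totalDeriv1 ν (fun p => (Q p).1 κ) j.1 • j.2 κ μ

/-- The second prolongation `Q_(2)`, a vector field on the second-order jet space. -/
def prolong {n : ℕ} (Q : Base n → Base n) (j : Jet2 n) : Jet2 n :=
  ((Q j.1.1, fun μ => prol1 Q μ j.1), fun μ ν => prol2 Q μ ν j)

/-- The left-hand side `i ψ_t + ψ_{aa} + S(t, x, |ψ|) ψ` of the equation, as a function of jets. -/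
def eqn {n : ℕ} (S : (Fin (n + 1) → ℝ) × ℝ → ℂ) (j : Jet2 n) : ℂ :=
  Complex.I * j.1.2 0 + ∑ a : Fin n, j.2 a.succ a.succ + S (j.1.1.1, ‖j.1.1.2‖) * j.1.1.2

/-- The infinitesimal invariance criterion: `Q_(2)` applied to the left-hand side of the equation
vanishes at all second-order jets over `dom Ω` that satisfy the equation. -/
def InvCriterion {n : ℕ} (Ω : Set ((Fin (n + 1) → ℝ) × ℝ)) (S : (Fin (n + 1) → ℝ) × ℝ → ℂ)
    (Q : Base n → Base n) : Prop :=
  ∀ j : Jet2 n, j.1.1 ∈ dom Ω → (∀ μ ν, j.2 μ ν = j.2 ν μ) → eqn S j = 0 →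
    fderiv ℝ (eqn S) j (prolong Q j) = 0

lemma isOpen_dom {n : ℕ} {Ω : Set ((Fin (n + 1) → ℝ) × ℝ)} (h : IsOpen Ω) : IsOpen (dom Ω) :=
  h.preimage (by fun_prop : Continuous fun p : Base n => (p.1, ‖p.2‖))

section linearity

variable {n : ℕ} {M : Set (Base n)} {Q R : Base n → Base n}

lemma smooth_fst (hM : IsOpen M) (hQ : ContDiffOn ℝ ∞ Q M) (ν : Fin (n + 1)) {p : Base n}
    (hp : p ∈ M) : ContDiffAt ℝ ∞ (fun p => (Q p).1 ν) p :=
  (contDiffAt_pi.1 (contDiffAt_fst.comp p (hQ.contDiffAt (hM.mem_nhds hp)))) ν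

lemma smooth_snd (hM : IsOpen M) (hQ : ContDiffOn ℝ ∞ Q M) {p : Base n}
    (hp : p ∈ M) : ContDiffAt ℝ ∞ (fun p => (Q p).2) p :=
  contDiffAt_snd.comp p (hQ.contDiffAt (hM.mem_nhds hp))

lemma totalDeriv1_differentiableAt {F : Type*} [NormedAddCommGroup F] [NormedSpace ℝ F]
    {f : Base n → F} {j : Jet1 n} (hf : ContDiffAt ℝ ∞ f j.1) (μ : Fin (n + 1)) :
    DifferentiableAt ℝ (totalDeriv1 μ f) j := by
  have h1 : DifferentiableAt ℝ (fderiv ℝ f) j.1 :=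
    (hf.fderiv_right (m := 1) (by norm_cast)).differentiableAt (by norm_num)
  have h2 : DifferentiableAt ℝ (fun j : Jet1 n => fderiv ℝ f j.1) j :=
    h1.comp j differentiableAt_fst
  have h3 : DifferentiableAt ℝ
      (fun j : Jet1 n => ((Pi.single μ 1, j.2 μ) : Base n)) j := by fun_prop
  exact h2.clm_apply h3

lemma prol1_differentiableAt (hM : IsOpen M) (hQ : ContDiffOn ℝ ∞ Q M) {j : Jet1 n}
    (hj : j.1 ∈ M) (μ : Fin (n + 1)) : DifferentiableAt ℝ (prol1 Q μ) j := by
  unfold prol1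
  refine (totalDeriv1_differentiableAt (smooth_snd hM hQ hj) μ).sub ?_
  refine DifferentiableAt.fun_sum fun ν _ => ?_
  exact (totalDeriv1_differentiableAt (smooth_fst hM hQ ν hj) μ).smul (by fun_prop)

lemma totalDeriv1_lin {F : Type*} [NormedAddCommGroup F] [NormedSpace ℝ F]
    {f g : Base n → F} {j : Jet1 n} (hf : ContDiffAt ℝ ∞ f j.1) (hg : ContDiffAt ℝ ∞ g j.1)
    (c : ℝ) (μ : Fin (n + 1)) :
    totalDeriv1 μ (fun p => c • f p + g p) j = c • totalDeriv1 μ f j + totalDeriv1 μ g j := by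
  have hf' := hf.differentiableAt (by simp)
  have hg' := hg.differentiableAt (by simp)
  unfold totalDeriv1
  rw [fderiv_fun_add (hf'.fun_const_smul c) hg', fderiv_fun_const_smul hf']
  simp

lemma prol1_lin (hM : IsOpen M) (hQ : ContDiffOn ℝ ∞ Q M) (hR : ContDiffOn ℝ ∞ R M) (c : ℝ)
    {j : Jet1 n} (hj : j.1 ∈ M) (μ : Fin (n + 1)) :
    prol1 (fun p => c • Q p + R p) μ j = c • prol1 Q μ j + prol1 R μ j := by
  have h1 := totalDeriv1_lin (smooth_snd hM hQ hj) (smooth_snd hM hR hj) c μ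
  have h2 := fun ν => totalDeriv1_lin (smooth_fst hM hQ ν hj) (smooth_fst hM hR ν hj) c μ
  simp only [prol1, Prod.snd_add, Prod.smul_snd, Prod.fst_add, Prod.smul_fst, Pi.add_apply,
    Pi.smul_apply, h1, h2, add_smul, Finset.sum_add_distrib, smul_sub, Finset.smul_sum, smul_assoc]
  abel

lemma prol2_lin (hM : IsOpen M) (hQ : ContDiffOn ℝ ∞ Q M) (hR : ContDiffOn ℝ ∞ R M) (c : ℝ)
    {j : Jet2 n} (hj : j.1.1 ∈ M) (μ ν : Fin (n + 1)) :
    prol2 (fun p => c • Q p + R p) μ ν j = c • prol2 Q μ ν j + prol2 R μ ν j := by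
  have h2 := fun κ => totalDeriv1_lin (smooth_fst hM hQ κ hj) (smooth_fst hM hR κ hj) c ν
  have hev : prol1 (fun p => c • Q p + R p) μ =ᶠ[nhds j.1]
      fun i => c • prol1 Q μ i + prol1 R μ i := by
    filter_upwards [(hM.preimage continuous_fst).mem_nhds hj] with i hi
    exact prol1_lin hM hQ hR c hi μ
  have hQ' := prol1_differentiableAt hM hQ hj μ
  have hR' := prol1_differentiableAt hM hR hj μ
  have h1 : totalDeriv2 ν (prol1 (fun p => c • Q p + R p) μ) j
      = c • totalDeriv2 ν (prol1 Q μ) j + totalDeriv2 ν (prol1 R μ) j := by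
    unfold totalDeriv2
    rw [hev.fderiv_eq, fderiv_fun_add (hQ'.fun_const_smul c) hR', fderiv_fun_const_smul hQ']
    simp
  simp only [prol2, h1, Prod.fst_add, Prod.smul_fst, Pi.add_apply,
    Pi.smul_apply, h2, add_smul, Finset.sum_add_distrib, smul_sub, Finset.smul_sum, smul_assoc]
  abel

lemma prolong_lin (hM : IsOpen M) (hQ : ContDiffOn ℝ ∞ Q M) (hR : ContDiffOn ℝ ∞ R M) (c : ℝ)
    {j : Jet2 n} (hj : j.1.1 ∈ M) :
    prolong (fun p => c • Q p + R p) j = c • prolong Q j + prolong R j := by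
  refine Prod.ext (Prod.ext rfl ?_) ?_
  · funext μ
    exact prol1_lin hM hQ hR c hj μ
  · funext μ ν
    exact prol2_lin hM hQ hR c hj μ ν

end linearity

lemma prolong_zero {n : ℕ} (j : Jet2 n) : prolong (0 : Base n → Base n) j = 0 := by
  have h : ∀ μ, prol1 (0 : Base n → Base n) μ = fun _ => 0 := by
    intro μ
    funext i
    simp [prol1, totalDeriv1]
  refine Prod.ext (Prod.ext rfl ?_) ?_
  · funext μ
    simp [prolong, h]
  · funext μ ν
    simp [prolong, prol2, h, totalDeriv1, totalDeriv2]

lemma lin_mem {n : ℕ} {Ω : Set ((Fin (n + 1) → ℝ) × ℝ)} (hΩ : IsOpen Ω)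
    {S : (Fin (n + 1) → ℝ) × ℝ → ℂ} {Q R : Base n → Base n}
    (hQ : ContDiffOn ℝ ∞ Q (dom Ω)) (hR : ContDiffOn ℝ ∞ R (dom Ω))
    (hQi : InvCriterion Ω S Q) (hRi : InvCriterion Ω S R) (c : ℝ) :
    InvCriterion Ω S (fun p => c • Q p + R p) := by
  intro j hj hs he
  rw [prolong_lin (isOpen_dom hΩ) hQ hR c hj, map_add, map_smul, hQi j hj hs he, hRi j hj hs he]
  simp

/-- The maximal Lie invariance algebra `𝔤_S` over `Ω`, as a real vector space: all smooth vector
fields on `dom Ω` that satisfy the infinitesimal invariance criterion. A vector field on `dom Ω` is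
represented by its extension by zero, so that distinct elements differ on `dom Ω`. -/
def lieInvAlg {n : ℕ} {Ω : Set ((Fin (n + 1) → ℝ) × ℝ)} (hΩ : IsDomainRho Ω)
    (S : (Fin (n + 1) → ℝ) × ℝ → ℂ) : Submodule ℝ (Base n → Base n) where
  carrier := {Q | ContDiffOn ℝ ∞ Q (dom Ω) ∧ (∀ p, p ∉ dom Ω → Q p = 0) ∧ InvCriterion Ω S Q}
  zero_mem' := by
    refine ⟨contDiffOn_const, fun _ _ => rfl, fun j _ _ _ => ?_⟩
    rw [prolong_zero, map_zero]
  add_mem' := by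
    rintro Q R ⟨hQ, hQ0, hQi⟩ ⟨hR, hR0, hRi⟩
    refine ⟨hQ.add hR, fun p hp => by simp [hQ0 p hp, hR0 p hp], ?_⟩
    simpa [Pi.add_def] using lin_mem hΩ.isOpen hQ hR hQi hRi 1
  smul_mem' := by
    rintro c Q ⟨hQ, hQ0, hQi⟩
    refine ⟨contDiffOn_const.smul hQ, fun p hp => by simp [hQ0 p hp], ?_⟩
    have hz : InvCriterion Ω S (0 : Base n → Base n) := fun j _ _ _ => by
      rw [prolong_zero, map_zero]
    have he : c • Q = fun p => c • Q p + (0 : Base n → Base n) p := by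
      funext p
      simp
    rw [he]
    exact lin_mem hΩ.isOpen hQ contDiffOn_const hQi hz c

/-- `S = ρ^{4/n}`. -/
def powerS (n : ℕ) (q : (Fin (n + 1) → ℝ) × ℝ) : ℂ := ((q.2 ^ (4 / (n : ℝ)) : ℝ) : ℂ)

end NLS

end

/-!
Collecting the powers of the jet variables in the criterion shows that `(τ, ξ)` depends on `(t, x)`
only and is conformal, and that `η` is holomorphic in `ψ` with `ζ = η_ψ` independent of `ψ`. The
potential is invariant under rotations of the phase of `ψ` while `η - ζ ψ` is not, so `S_ρ ≠ 0`
forces `η = ζ ψ`. What remains of the criterion expresses the first derivatives of the jet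
`(ξ, ζ, ∂_t ξ, ∂_b ξ^a, τ_tt)` linearly in the jet itself, so `Q` is determined by the value of the
jet at one point. At a point with `S_ρ ≠ 0` the classifying equation, differentiated in `ρ`,
moreover gives `τ_t` in terms of `ξ` and `ζ`, and the conformal Killing equation leaves only the
entries `∂_b ξ^a` with `b < a`; the remaining data are
`1 + n + 2 + n + 1 + n(n-1)/2 = n(n+3)/2 + 4` real numbers. For `S = ρ^{4/n}` the terms of the
classifying equation with `S` cancel when `Re ζ = -(n/4) τ_t`, and the data can be prescribed
arbitrarily.
-/

open scoped ContDiff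

noncomputable section

namespace NLS

section DirectionalDerivative

variable {E F : Type*} [NormedAddCommGroup E] [NormedSpace ℝ E]
  [NormedAddCommGroup F] [NormedSpace ℝ F] {M : Set E} {f g : E → F} {p : E}

/-- The derivative of `f` in the constant direction `v`, as a function of the point. It is defined
through `fderiv`, hence additive in `v` without further assumptions. -/
def dirDeriv (v : E) (f : E → F) (p : E) : F := fderiv ℝ f p v

lemma differentiableAt_of_contDiffOn (hM : IsOpen M) (hf : ContDiffOn ℝ ∞ f M) (hp : p ∈ M) :
    DifferentiableAt ℝ f p :=
  (hf.contDiffAt (hM.mem_nhds hp)).differentiableAt (by simp)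

lemma contDiffOn_dirDeriv (hM : IsOpen M) (hf : ContDiffOn ℝ ∞ f M) (v : E) :
    ContDiffOn ℝ ∞ (dirDeriv v f) M :=
  (hf.fderiv_of_isOpen (m := ∞) hM (by simp)).clm_apply contDiffOn_const

lemma dirDeriv_congr (hM : IsOpen M) (h : Set.EqOn f g M) (v : E) :
    Set.EqOn (dirDeriv v f) (dirDeriv v g) M := fun p hp => by
  rw [dirDeriv, (h.eventuallyEq_of_mem (hM.mem_nhds hp)).fderiv_eq, dirDeriv]

lemma dirDeriv_dirDeriv (hM : IsOpen M) (hf : ContDiffOn ℝ ∞ f M) (hp : p ∈ M) (v w : E) :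
    dirDeriv v (dirDeriv w f) p = fderiv ℝ (fderiv ℝ f) p v w := by
  have hd : DifferentiableAt ℝ (fderiv ℝ f) p :=
    differentiableAt_of_contDiffOn hM (hf.fderiv_of_isOpen (m := ∞) hM (by simp)) hp
  unfold dirDeriv
  rw [fderiv_clm_apply hd (differentiableAt_const w)]
  simp

lemma dirDeriv_comm (hM : IsOpen M) (hf : ContDiffOn ℝ ∞ f M) (v w : E) :
    Set.EqOn (dirDeriv v (dirDeriv w f)) (dirDeriv w (dirDeriv v f)) M := fun p hp => by
  have hsymm : IsSymmSndFDerivAt ℝ f p :=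
    (hf.contDiffAt (hM.mem_nhds hp)).isSymmSndFDerivAt (by simp; norm_cast)
  rw [dirDeriv_dirDeriv hM hf hp, dirDeriv_dirDeriv hM hf hp, hsymm v w]

lemma dirDeriv_add_vec (f : E → F) (v w p : E) :
    dirDeriv (v + w) f p = dirDeriv v f p + dirDeriv w f p := by
  simp [dirDeriv]

lemma dirDeriv_smul_vec (f : E → F) (c : ℝ) (v p : E) :
    dirDeriv (c • v) f p = c • dirDeriv v f p := by
  simp [dirDeriv]

lemma dirDeriv_zero_vec (f : E → F) (p : E) : dirDeriv 0 f p = 0 := by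
  simp [dirDeriv]

lemma dirDeriv_const (v : E) (c : F) : dirDeriv v (fun _ => c) = 0 := by
  funext p
  simp [dirDeriv]

lemma dirDeriv_eq_zero_of_eqOn_const (hM : IsOpen M) {c : F} (h : ∀ p ∈ M, f p = c) (v : E)
    (hp : p ∈ M) : dirDeriv v f p = 0 := by
  rw [dirDeriv_congr hM h v hp, dirDeriv_const, Pi.zero_apply]

lemma dirDeriv_add (hf : DifferentiableAt ℝ f p) (hg : DifferentiableAt ℝ g p) (v : E) :
    dirDeriv v (fun q => f q + g q) p = dirDeriv v f p + dirDeriv v g p := by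
  simp [dirDeriv, fderiv_fun_add hf hg]

lemma dirDeriv_const_smul (c : ℝ) (v : E) (f : E → F) :
    dirDeriv v (c • f) = c • dirDeriv v f := by
  funext p
  simp [dirDeriv, fderiv_const_smul_field]

lemma dirDeriv_sub (hf : DifferentiableAt ℝ f p) (hg : DifferentiableAt ℝ g p) (v : E) :
    dirDeriv v (fun q => f q - g q) p = dirDeriv v f p - dirDeriv v g p := by
  simp [dirDeriv, fderiv_fun_sub hf hg]

lemma dirDeriv_sum {ι : Type*} {s : Finset ι} {f : ι → E → F}
    (hf : ∀ i ∈ s, DifferentiableAt ℝ (f i) p) (v : E) :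
    dirDeriv v (fun q => ∑ i ∈ s, f i q) p = ∑ i ∈ s, dirDeriv v (f i) p := by
  simp [dirDeriv, fderiv_fun_sum hf]

lemma dirDeriv_smul {c : E → ℝ} (hc : DifferentiableAt ℝ c p) (hf : DifferentiableAt ℝ f p)
    (v : E) : dirDeriv v (fun q => c q • f q) p = dirDeriv v c p • f p + c p • dirDeriv v f p := by
  simp [dirDeriv, fderiv_fun_smul hc hf, add_comm]

lemma dirDeriv_mul {A : Type*} [NormedCommRing A] [NormedAlgebra ℝ A] {f g : E → A}
    (hf : DifferentiableAt ℝ f p) (hg : DifferentiableAt ℝ g p) (v : E) :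
    dirDeriv v (fun q => f q * g q) p = dirDeriv v f p * g p + f p * dirDeriv v g p := by
  simp [dirDeriv, fderiv_fun_mul hf hg, mul_comm, add_comm]

lemma dirDeriv_const_mul {A : Type*} [NormedCommRing A] [NormedAlgebra ℝ A] {f : E → A}
    (hf : DifferentiableAt ℝ f p) (c : A) (v : E) :
    dirDeriv v (fun q => c * f q) p = c * dirDeriv v f p := by
  rw [dirDeriv_mul (differentiableAt_const c) hf, dirDeriv_const]
  simp

lemma dirDeriv_clm_comp {G : Type*} [NormedAddCommGroup G] [NormedSpace ℝ G] (L : F →L[ℝ] G)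
    (hf : DifferentiableAt ℝ f p) (v : E) :
    dirDeriv v (fun q => L (f q)) p = L (dirDeriv v f p) := by
  have := (L.hasFDerivAt.comp p hf.hasFDerivAt).fderiv
  simp only [Function.comp_def] at this
  simp [dirDeriv, this]

lemma dirDeriv_prodMk {G : Type*} [NormedAddCommGroup G] [NormedSpace ℝ G] {g : E → G}
    (hf : DifferentiableAt ℝ f p) (hg : DifferentiableAt ℝ g p) (v : E) :
    dirDeriv v (fun q => (f q, g q)) p = (dirDeriv v f p, dirDeriv v g p) := by
  rw [dirDeriv, hf.fderiv_prodMk hg]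
  rfl

lemma dirDeriv_pi {ι : Type*} [Fintype ι] {f : E → ι → F}
    (hf : ∀ i, DifferentiableAt ℝ (fun q => f q i) p) (v : E) :
    dirDeriv v f p = fun i => dirDeriv v (fun q => f q i) p := by
  rw [dirDeriv, fderiv_pi hf]
  rfl

lemma dirDeriv_clm_apply {G : Type*} [NormedAddCommGroup G] [NormedSpace ℝ G]
    {L : E → F →L[ℝ] G} (hL : DifferentiableAt ℝ L p) (hf : DifferentiableAt ℝ f p) (v : E) :
    dirDeriv v (fun q => L q (f q)) p = dirDeriv v L p (f p) + L p (dirDeriv v f p) := by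
  rw [dirDeriv, fderiv_clm_apply hL hf, add_comm]
  rfl

lemma dirDeriv_dirDeriv_eq_zero (hM : IsOpen M) (hf : ContDiffOn ℝ ∞ f M) {v : E}
    (h : ∀ p ∈ M, dirDeriv v f p = 0) (w : E) (hp : p ∈ M) :
    dirDeriv v (dirDeriv w f) p = 0 := by
  rw [dirDeriv_comm hM hf v w hp, dirDeriv_eq_zero_of_eqOn_const hM h w hp]

lemma hasDerivAt_comp_segment {t : ℝ} {v : E} (hf : DifferentiableAt ℝ f (p + t • v)) :
    HasDerivAt (fun t : ℝ => f (p + t • v)) (dirDeriv v f (p + t • v)) t :=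
  hf.hasFDerivAt.comp_hasDerivAt t (by simpa using ((hasDerivAt_id t).smul_const v).const_add p)

lemma dirDeriv_eq_of_quadratic {L R : F} (hf : DifferentiableAt ℝ f p) {v : E}
    (h : ∀ t : ℝ, f (p + t • v) = f p + t • L + (t ^ 2) • R) : dirDeriv v f p = L := by
  have hseg : HasDerivAt (fun t : ℝ => f (p + t • v)) (dirDeriv v f p) 0 := by
    simpa using hasDerivAt_comp_segment (t := 0) (v := v) (by simpa using hf)
  have hquad : HasDerivAt (fun t : ℝ => f p + t • L + (t ^ 2) • R) L 0 := by
    simpa using (((hasDerivAt_id (0 : ℝ)).smul_const L).const_add (f p)).fun_add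
      (((hasDerivAt_id (0 : ℝ)).pow 2).smul_const R)
  rw [funext h] at hseg
  exact hseg.unique hquad

lemma dirDeriv_eq_of_affine {L : F} (hf : DifferentiableAt ℝ f p) {v : E}
    (h : ∀ t : ℝ, f (p + t • v) = f p + t • L) : dirDeriv v f p = L :=
  dirDeriv_eq_of_quadratic (R := 0) hf fun t => by rw [h, smul_zero, add_zero]

end DirectionalDerivative

section LinearSystem

variable {E V F G : Type*} [NormedAddCommGroup E] [NormedSpace ℝ E]
  [NormedAddCommGroup V] [NormedSpace ℝ V] [NormedAddCommGroup F] [NormedSpace ℝ F]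
  [NormedAddCommGroup G] [NormedSpace ℝ G]
  {M : Set E} {y : E → V} {f g : E → F}

/-- On `M`, the function `f` depends linearly on the unknown `y`, with smooth coefficients. A linear
first-order differential system for `y` is closed if each derivative of `y` is of this form. -/
def SmoothLinear (M : Set E) (y : E → V) (f : E → F) : Prop :=
  ∃ L : E → V →L[ℝ] F, ContDiffOn ℝ ∞ L M ∧ ∀ p ∈ M, f p = L p (y p)

namespace SmoothLinear

lemma congr (hf : SmoothLinear M y f) (h : Set.EqOn g f M) : SmoothLinear M y g :=
  let ⟨L, hL, hfL⟩ := hf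
  ⟨L, hL, fun p hp => (h hp).trans (hfL p hp)⟩

lemma of_eq_zero (h : ∀ p ∈ M, f p = 0) : SmoothLinear M y f :=
  ⟨0, contDiffOn_const, h⟩

lemma self (M : Set E) (y : E → V) : SmoothLinear M y y :=
  ⟨fun _ => ContinuousLinearMap.id ℝ V, contDiffOn_const, fun _ _ => rfl⟩

lemma comp_clm (hf : SmoothLinear M y f) {T : E → F →L[ℝ] G} (hT : ContDiffOn ℝ ∞ T M) :
    SmoothLinear M y fun p => T p (f p) :=
  let ⟨L, hL, hfL⟩ := hf
  ⟨fun p => (T p).comp (L p), hT.clm_comp hL, fun p hp => congrArg (T p) (hfL p hp)⟩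

lemma const_clm (hf : SmoothLinear M y f) (T : F →L[ℝ] G) : SmoothLinear M y fun p => T (f p) :=
  hf.comp_clm contDiffOn_const

lemma fst {f : E → F × G} (hf : SmoothLinear M y f) : SmoothLinear M y fun p => (f p).1 :=
  hf.const_clm (ContinuousLinearMap.fst ℝ F G)

lemma snd {f : E → F × G} (hf : SmoothLinear M y f) : SmoothLinear M y fun p => (f p).2 :=
  hf.const_clm (ContinuousLinearMap.snd ℝ F G)

lemma apply {ι : Type*} [Fintype ι] {f : E → ι → F} (hf : SmoothLinear M y f) (i : ι) :
    SmoothLinear M y fun p => f p i :=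
  hf.const_clm (ContinuousLinearMap.proj (φ := fun _ : ι => F) i)

lemma smul_right {c : E → ℝ} (hc : SmoothLinear M y c) (hf : ContDiffOn ℝ ∞ f M) :
    SmoothLinear M y fun p => c p • f p :=
  hc.comp_clm (contDiffOn_const.smulRight hf : ContDiffOn ℝ ∞
    (fun p => (ContinuousLinearMap.id ℝ ℝ).smulRight (f p)) M)

lemma add (hf : SmoothLinear M y f) (hg : SmoothLinear M y g) :
    SmoothLinear M y fun p => f p + g p :=
  let ⟨L, hL, hfL⟩ := hf
  let ⟨K, hK, hgK⟩ := hg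
  ⟨fun p => L p + K p, hL.add hK, fun p hp => congrArg₂ _ (hfL p hp) (hgK p hp)⟩

lemma const_smul (hf : SmoothLinear M y f) (c : ℝ) : SmoothLinear M y fun p => c • f p :=
  hf.const_clm (c • ContinuousLinearMap.id ℝ F)

lemma sum {ι : Type*} (s : Finset ι) {f : ι → E → F} (hf : ∀ i ∈ s, SmoothLinear M y (f i)) :
    SmoothLinear M y fun p => ∑ i ∈ s, f i p := by
  choose! L hL hfL using hf
  exact ⟨fun p => ∑ i ∈ s, L i p, ContDiffOn.sum hL, fun p hp => by
    rw [sum_apply]; exact Finset.sum_congr rfl fun i hi => hfL i hi p hp⟩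

lemma prodMk {g : E → G} (hf : SmoothLinear M y f) (hg : SmoothLinear M y g) :
    SmoothLinear M y fun p => (f p, g p) :=
  ((hf.const_clm (ContinuousLinearMap.inl ℝ F G)).add
    (hg.const_clm (ContinuousLinearMap.inr ℝ F G))).congr fun p _ => by simp

lemma pi {ι : Type*} [Fintype ι] {f : ι → E → F} (hf : ∀ i, SmoothLinear M y (f i)) :
    SmoothLinear M y fun p i => f i p := by
  classical
  exact (sum Finset.univ fun i _ =>
    (hf i).const_clm (ContinuousLinearMap.single ℝ (fun _ => F) i)).congr
      fun p _ => (Finset.univ_sum_single _).symm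

lemma dirDeriv (hM : IsOpen M) (hy : ContDiffOn ℝ ∞ y M) {v : E}
    (hv : SmoothLinear M y (dirDeriv v y)) (hf : SmoothLinear M y f) :
    SmoothLinear M y (dirDeriv v f) := by
  obtain ⟨L, hL, hfL⟩ := hf
  have h1 : SmoothLinear M y fun p => NLS.dirDeriv v L p (y p) :=
    ⟨_, contDiffOn_dirDeriv hM hL v, fun _ _ => rfl⟩
  refine (h1.add (hv.comp_clm hL)).congr fun p hp => ?_
  rw [dirDeriv_congr hM hfL v hp, dirDeriv_clm_apply (differentiableAt_of_contDiffOn hM hL hp)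
    (differentiableAt_of_contDiffOn hM hy hp)]

end SmoothLinear

lemma eq_zero_of_hasDerivAt_linear {A : ℝ → V →L[ℝ] V} {a b : ℝ} (hab : a ≤ b)
    (hA : ContinuousOn A (Set.Icc a b)) {u : ℝ → V}
    (hu : ∀ t ∈ Set.Icc a b, HasDerivAt u (A t (u t)) t) (ha : u a = 0) : u b = 0 := by
  obtain ⟨K, hK⟩ := isCompact_Icc.exists_bound_of_continuousOn hA
  have key := norm_le_gronwallBound_of_norm_deriv_right_le (δ := 0) (K := K) (ε := 0)
    (fun t ht => (hu t ht).continuousAt.continuousWithinAt)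
    (fun t ht => (hu t (Set.Ico_subset_Icc_self ht)).hasDerivWithinAt) (by simp [ha])
    (fun t ht => by simpa using (A t).le_of_opNorm_le (hK t (Set.Ico_subset_Icc_self ht)) (u t))
    b (Set.right_mem_Icc.2 hab)
  rwa [gronwallBound_ε0_δ0, norm_le_zero_iff] at key

lemma eq_zero_of_segment (hM : IsOpen M) (hy : ContDiffOn ℝ ∞ y M) {p v : E}
    (hv : SmoothLinear M y (dirDeriv v y)) (hseg : ∀ t ∈ Set.Icc (0 : ℝ) 1, p + t • v ∈ M)
    (hp : y p = 0) : y (p + v) = 0 := by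
  obtain ⟨L, hL, hyL⟩ := hv
  have hend := eq_zero_of_hasDerivAt_linear (u := fun t : ℝ => y (p + t • v)) zero_le_one
    (hL.continuousOn.comp (by fun_prop) hseg) (fun t ht => by
      simpa only [Function.comp_apply, hyL _ (hseg t ht)] using
        hasDerivAt_comp_segment (differentiableAt_of_contDiffOn hM hy (hseg t ht))) (by simpa)
  simpa using hend

lemma eq_zero_of_closed_linear_system (hM : IsOpen M) (hc : IsPreconnected M)
    (hy : ContDiffOn ℝ ∞ y M) (hv : ∀ v, SmoothLinear M y (dirDeriv v y)) {p₀ : E}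
    (hp₀ : p₀ ∈ M) (h0 : y p₀ = 0) : ∀ p ∈ M, y p = 0 := by
  have hopen_ne : IsOpen (M ∩ y ⁻¹' {0}ᶜ) :=
    hy.continuousOn.isOpen_inter_preimage hM isOpen_compl_singleton
  have hopen_eq : IsOpen (M ∩ y ⁻¹' {0}) := by
    rw [Metric.isOpen_iff]
    rintro p ⟨hp, hyp⟩
    obtain ⟨ε, hε, hball⟩ := Metric.isOpen_iff.1 hM p hp
    refine ⟨ε, hε, fun q hq => ⟨hball hq, ?_⟩⟩
    simpa using eq_zero_of_segment hM hy (hv (q - p))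
      (fun t ht => hball ((convex_ball p ε).add_smul_sub_mem (Metric.mem_ball_self hε) hq ht)) hyp
  by_contra! hne
  obtain ⟨p, hp, hyp⟩ := hne
  obtain ⟨q, _, hq, hq'⟩ := hc _ _ hopen_eq hopen_ne
    (fun q hq => (em (y q = 0)).imp (fun h => ⟨hq, h⟩) fun h => ⟨hq, h⟩)
    ⟨p₀, hp₀, hp₀, h0⟩ ⟨p, hp, hp, hyp⟩
  exact hq'.2 hq.2

end LinearSystem

/-- The coordinate vector `∂_μ` on the space of the variables `(t, x, ψ)`. -/
abbrev coordVec {n : ℕ} (μ : Fin (n + 1)) : Base n := (Pi.single μ 1, 0)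

/-- The vertical vector `c ∂_ψ + c* ∂_{ψ*}`. -/
abbrev vert {n : ℕ} (c : ℂ) : Base n := (0, c)

/-- The vector `∂_μ + c ∂_ψ + c* ∂_{ψ*}`, along which the total derivative `D_μ` differentiates at a
jet with `ψ_μ = c`. -/
abbrev totVec {n : ℕ} (μ : Fin (n + 1)) (c : ℂ) : Base n := (Pi.single μ 1, c)

local notation "∂ₜ" => dirDeriv (coordVec 0)
local notation "∂ₓ[" a "]" => dirDeriv (coordVec (Fin.succ a))
local notation "∂ψ[" c "]" => dirDeriv (vert c)

section Prolongation

variable {n : ℕ} {M : Set (Base n)} {Q : Base n → Base n}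

/-- The coefficient `ξ^μ` of `Q`, where `ξ^0 = τ`. -/
def xi (Q : Base n → Base n) (μ : Fin (n + 1)) (p : Base n) : ℝ := (Q p).1 μ

/-- The coefficient `η` of `Q`. -/
def eta (Q : Base n → Base n) (p : Base n) : ℂ := (Q p).2

/-- The function `S(t, x, |ψ|)` of `(t, x, ψ)`. -/
def potential (S : (Fin (n + 1) → ℝ) × ℝ → ℂ) (p : Base n) : ℂ := S (p.1, ‖p.2‖)

lemma contDiffOn_xi (hQ : ContDiffOn ℝ ∞ Q M) (μ : Fin (n + 1)) : ContDiffOn ℝ ∞ (xi Q μ) M :=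
  contDiffOn_pi.1 (contDiff_fst.comp_contDiffOn hQ) μ

lemma contDiffOn_eta (hQ : ContDiffOn ℝ ∞ Q M) : ContDiffOn ℝ ∞ (eta Q) M :=
  contDiff_snd.comp_contDiffOn hQ

lemma totalDeriv2_totalDeriv1 {F : Type*} [NormedAddCommGroup F] [NormedSpace ℝ F]
    (hM : IsOpen M) {f : Base n → F} (hf : ContDiffOn ℝ ∞ f M) (μ ν : Fin (n + 1)) {j : Jet2 n}
    (hj : j.1.1 ∈ M) :
    totalDeriv2 ν (totalDeriv1 μ f) j
      = dirDeriv (totVec ν (j.1.2 ν)) (dirDeriv (totVec μ (j.1.2 μ)) f) j.1.1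
        + ∂ψ[j.2 ν μ] f j.1.1 := by
  have hdf : DifferentiableAt ℝ (fderiv ℝ f) j.1.1 :=
    differentiableAt_of_contDiffOn hM (hf.fderiv_of_isOpen (m := ∞) hM (by simp)) hj
  have hdf' : HasFDerivAt (fun i : Jet1 n => fderiv ℝ f i.1)
      ((fderiv ℝ (fderiv ℝ f) j.1.1).comp (ContinuousLinearMap.fst ℝ _ _)) j.1 :=
    hdf.hasFDerivAt.comp j.1 hasFDerivAt_fst
  have hvec : dirDeriv ((Pi.single ν 1, j.1.2 ν), j.2 ν)
      (fun i : Jet1 n => (totVec μ (i.2 μ) : Base n)) j.1 = vert (j.2 ν μ) :=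
    dirDeriv_eq_of_affine (by fun_prop) fun t => by simp
  calc totalDeriv2 ν (totalDeriv1 μ f) j
      = dirDeriv ((Pi.single ν 1, j.1.2 ν), j.2 ν)
          (fun i : Jet1 n => fderiv ℝ f i.1 (totVec μ (i.2 μ))) j.1 := rfl
    _ = _ := by
      rw [dirDeriv_clm_apply hdf'.differentiableAt (by fun_prop), hvec, dirDeriv, hdf'.fderiv,
        dirDeriv_dirDeriv hM hf hj]
      rfl

lemma totalDeriv2_prol1 (hM : IsOpen M) (hQ : ContDiffOn ℝ ∞ Q M) (μ ν : Fin (n + 1))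
    {j : Jet2 n} (hj : j.1.1 ∈ M) :
    totalDeriv2 ν (prol1 Q μ) j
      = totalDeriv2 ν (totalDeriv1 μ (eta Q)) j
        - ∑ κ, (totalDeriv2 ν (totalDeriv1 μ (xi Q κ)) j • j.1.2 κ
          + totalDeriv1 μ (xi Q κ) j.1 • j.2 ν κ) := by
  have hη := totalDeriv1_differentiableAt (smooth_snd hM hQ hj) μ
  have hξ := fun κ => totalDeriv1_differentiableAt (smooth_fst hM hQ κ hj) μ
  have hu : ∀ κ, DifferentiableAt ℝ (fun i : Jet1 n => i.2 κ) j.1 := fun κ => by fun_prop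
  have hjet : ∀ κ, dirDeriv ((Pi.single ν 1, j.1.2 ν), j.2 ν) (fun i : Jet1 n => i.2 κ) j.1
      = j.2 ν κ := fun κ => dirDeriv_eq_of_affine (hu κ) fun t => by simp
  calc totalDeriv2 ν (prol1 Q μ) j
      = dirDeriv ((Pi.single ν 1, j.1.2 ν), j.2 ν) (fun i : Jet1 n =>
          totalDeriv1 μ (fun p => (Q p).2) i
            - ∑ κ, totalDeriv1 μ (fun p => (Q p).1 κ) i • i.2 κ) j.1 := rfl
    _ = _ := by
      rw [dirDeriv_sub hη (.fun_sum fun κ _ => (hξ κ).fun_smul (hu κ)),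
        dirDeriv_sum fun κ _ => (hξ κ).fun_smul (hu κ)]
      simp only [dirDeriv_smul (hξ _) (hu _), hjet]
      rfl

lemma fderiv_eqn {S : (Fin (n + 1) → ℝ) × ℝ → ℂ} {j : Jet2 n}
    (hS : DifferentiableAt ℝ (potential S) j.1.1) (V : Jet2 n) :
    fderiv ℝ (eqn S) j V = Complex.I * V.1.2 0 + ∑ a : Fin n, V.2 a.succ a.succ
      + (dirDeriv V.1.1 (potential S) j.1.1 * j.1.1.2 + potential S j.1.1 * V.1.1.2) := by
  have hlin : dirDeriv V (fun i : Jet2 n => Complex.I * i.1.2 0 + ∑ a : Fin n, i.2 a.succ a.succ) j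
      = Complex.I * V.1.2 0 + ∑ a : Fin n, V.2 a.succ a.succ :=
    dirDeriv_eq_of_affine (by fun_prop) fun t => by
      simp only [Prod.fst_add, Prod.snd_add, Prod.smul_fst, Prod.smul_snd, Pi.add_apply,
        Pi.smul_apply, Complex.real_smul, Finset.sum_add_distrib, ← Finset.mul_sum]
      ring
  have hψ : dirDeriv V (fun i : Jet2 n => i.1.1.2) j = V.1.1.2 :=
    dirDeriv_eq_of_affine (by fun_prop) fun t => by simp
  have hpot : HasFDerivAt (fun i : Jet2 n => potential S i.1.1)
      ((fderiv ℝ (potential S) j.1.1).comp ((ContinuousLinearMap.fst ℝ _ _).comp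
        (ContinuousLinearMap.fst ℝ _ _))) j :=
    hS.hasFDerivAt.comp (f := fun i : Jet2 n => i.1.1) j
      (hasFDerivAt_fst.comp (f := fun i : Jet2 n => i.1) j hasFDerivAt_fst)
  calc fderiv ℝ (eqn S) j V
      = dirDeriv V (fun i : Jet2 n => (Complex.I * i.1.2 0 + ∑ a : Fin n, i.2 a.succ a.succ)
          + potential S i.1.1 * i.1.1.2) j := rfl
    _ = _ := by
      rw [dirDeriv_add (by fun_prop) (hpot.differentiableAt.fun_mul (by fun_prop)), hlin,
        dirDeriv_mul hpot.differentiableAt (by fun_prop), hψ, dirDeriv, hpot.fderiv]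
      rfl

/-- The value of `Q_(2)` on the left-hand side of the equation with the potential `s`, at the jet
`((p, u), U)`, in terms of the coefficients of `Q`. -/
def prolAction (s : Base n → ℂ) (Q : Base n → Base n) (p : Base n) (u : Fin (n + 1) → ℂ)
    (U : Fin (n + 1) → Fin (n + 1) → ℂ) : ℂ :=
  Complex.I * (dirDeriv (totVec 0 (u 0)) (eta Q) p
      - ∑ κ, dirDeriv (totVec 0 (u 0)) (xi Q κ) p • u κ)
    + ∑ a : Fin n,
      (dirDeriv (totVec a.succ (u a.succ)) (dirDeriv (totVec a.succ (u a.succ)) (eta Q)) p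
        + ∂ψ[U a.succ a.succ] (eta Q) p
        - ∑ κ,
          ((dirDeriv (totVec a.succ (u a.succ)) (dirDeriv (totVec a.succ (u a.succ)) (xi Q κ)) p
            + ∂ψ[U a.succ a.succ] (xi Q κ) p) • u κ
          + dirDeriv (totVec a.succ (u a.succ)) (xi Q κ) p • (U a.succ κ + U κ a.succ)))
    + (dirDeriv (Q p) s p * p.2 + s p * eta Q p)

lemma prolAction_congr (hM : IsOpen M) {R : Base n → Base n} (h : Set.EqOn Q R M)
    {p : Base n} (hp : p ∈ M) (s : Base n → ℂ) :
    prolAction s Q p = prolAction s R p := by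
  have hξ : ∀ μ, Set.EqOn (xi Q μ) (xi R μ) M := fun μ q hq => by rw [xi, h hq, xi]
  have hη : Set.EqOn (eta Q) (eta R) M := fun q hq => by rw [eta, h hq, eta]
  have hdξ := fun μ v => dirDeriv_congr hM (hξ μ) v
  have hdη := fun v => dirDeriv_congr hM hη v
  funext u U
  simp only [prolAction, h hp, hη hp, hdξ _ _ hp, hdη _ hp, dirDeriv_congr hM (hdξ _ _) _ hp,
    dirDeriv_congr hM (hdη _) _ hp]

lemma fderiv_eqn_prolong (hM : IsOpen M) (hQ : ContDiffOn ℝ ∞ Q M)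
    {S : (Fin (n + 1) → ℝ) × ℝ → ℂ} {p : Base n} (hp : p ∈ M)
    (hS : DifferentiableAt ℝ (potential S) p) (u : Fin (n + 1) → ℂ)
    (U : Fin (n + 1) → Fin (n + 1) → ℂ) :
    fderiv ℝ (eqn S) ((p, u), U) (prolong Q ((p, u), U)) = prolAction (potential S) Q p u U := by
  have hprol2 : ∀ a : Fin n, prol2 Q a.succ a.succ ((p, u), U) = _ := fun a => by
    rw [prol2, totalDeriv2_prol1 hM hQ _ _ hp,
      totalDeriv2_totalDeriv1 hM (contDiffOn_eta hQ) _ _ hp,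
      Finset.sum_congr rfl fun κ _ => by
        rw [totalDeriv2_totalDeriv1 hM (contDiffOn_xi hQ κ) _ _ hp], sub_sub,
      ← Finset.sum_add_distrib]
  rw [fderiv_eqn hS]
  simp only [prolong, hprol2, prolAction, smul_add, add_assoc]
  rfl

/-- The infinitesimal invariance criterion on `M` for the equation with the potential `s`. -/
def InvariantOn (M : Set (Base n)) (s : Base n → ℂ) (Q : Base n → Base n) : Prop :=
  ∀ p ∈ M, ∀ (u : Fin (n + 1) → ℂ) (U : Fin (n + 1) → Fin (n + 1) → ℂ),
    (∀ μ ν, U μ ν = U ν μ) →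
    Complex.I * u 0 + ∑ a : Fin n, U a.succ a.succ + s p * p.2 = 0 → prolAction s Q p u U = 0

lemma invCriterion_iff_invariantOn {Ω : Set ((Fin (n + 1) → ℝ) × ℝ)} (hM : IsOpen (dom Ω))
    (hQ : ContDiffOn ℝ ∞ Q (dom Ω)) {S : (Fin (n + 1) → ℝ) × ℝ → ℂ}
    (hS : ContDiffOn ℝ ∞ (potential S) (dom Ω)) :
    InvCriterion Ω S Q ↔ InvariantOn (dom Ω) (potential S) Q := by
  have key := fun {p} (hp : p ∈ dom Ω) =>
    fderiv_eqn_prolong hM hQ hp (differentiableAt_of_contDiffOn hM hS hp)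
  exact ⟨fun h p hp u U hU he => (key hp u U).symm.trans (h ((p, u), U) hp hU he),
    fun h j hj hU he => (key hj j.1.2 j.2).trans (h j.1.1 hj j.1.2 j.2 hU he)⟩

end Prolongation

section DeterminingEquations

variable {n : ℕ} {M : Set (Base n)} {s : Base n → ℂ} {Q : Base n → Base n} {p : Base n}

lemma dirDeriv_totVec {F : Type*} [NormedAddCommGroup F] [NormedSpace ℝ F] (f : Base n → F)
    (μ : Fin (n + 1)) (c : ℂ) (p : Base n) :
    dirDeriv (totVec μ c) f p = dirDeriv (coordVec μ) f p + ∂ψ[c] f p := by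
  rw [← dirDeriv_add_vec, coordVec, vert, Prod.mk_add_mk, add_zero, zero_add]

lemma dirDeriv_vert_eq {F : Type*} [NormedAddCommGroup F] [NormedSpace ℝ F] (f : Base n → F)
    (p : Base n) (c : ℂ) : ∂ψ[c] f p = c.re • ∂ψ[1] f p + c.im • ∂ψ[Complex.I] f p := by
  rw [← dirDeriv_smul_vec, ← dirDeriv_smul_vec, ← dirDeriv_add_vec]
  simp [vert, Complex.re_add_im]

lemma dirDeriv_vert_zero {F : Type*} [NormedAddCommGroup F] [NormedSpace ℝ F] (f : Base n → F)
    (p : Base n) : ∂ψ[0] f p = 0 :=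
  dirDeriv_zero_vec f p

lemma dirDeriv_vert_add {F : Type*} [NormedAddCommGroup F] [NormedSpace ℝ F] (f : Base n → F)
    (p : Base n) (c d : ℂ) : ∂ψ[c + d] f p = ∂ψ[c] f p + ∂ψ[d] f p := by
  rw [← dirDeriv_add_vec, Prod.mk_add_mk, add_zero]

lemma prolAction_eq_add_second_order (p : Base n) (u : Fin (n + 1) → ℂ)
    (U : Fin (n + 1) → Fin (n + 1) → ℂ) :
    prolAction s Q p u U = prolAction s Q p u 0
      + ∑ a : Fin n, (∂ψ[U a.succ a.succ] (eta Q) p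
        - ∑ κ, (∂ψ[U a.succ a.succ] (xi Q κ) p • u κ
          + dirDeriv (totVec a.succ (u a.succ)) (xi Q κ) p • (U a.succ κ + U κ a.succ))) := by
  simp only [prolAction, Pi.zero_apply, dirDeriv_vert_zero, add_zero, smul_zero, add_smul,
    Finset.sum_add_distrib, Finset.sum_sub_distrib]
  ring

lemma prolAction_single (p : Base n) (u : Fin (n + 1) → ℂ) (a : Fin n) (c : ℂ) :
    prolAction s Q p u (fun μ ν => if μ = a.succ ∧ ν = a.succ then c else 0)
      = prolAction s Q p u 0 + (∂ψ[c] (eta Q) p - ∑ κ, ∂ψ[c] (xi Q κ) p • u κ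
        - dirDeriv (totVec a.succ (u a.succ)) (xi Q a.succ) p • (2 * c)) := by
  rw [prolAction_eq_add_second_order, Finset.sum_eq_single a
    (fun b _ hb => by simp [hb, dirDeriv_vert_zero]) (by simp)]
  simp only [and_self, if_true, true_and, and_true, Finset.sum_add_distrib, ← two_smul ℝ,
    smul_ite, smul_zero, Finset.sum_ite_eq', Finset.mem_univ, sub_sub]
  simp

lemma InvariantOn.sum_offdiag_eq_zero (h : InvariantOn M s Q) (hp : p ∈ M) {u : Fin (n + 1) → ℂ}
    (hu : Complex.I * u 0 + s p * p.2 = 0) {U : Fin (n + 1) → Fin (n + 1) → ℂ}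
    (hU : ∀ μ ν, U μ ν = U ν μ) (hdiag : ∀ a : Fin n, U a.succ a.succ = 0) :
    ∑ a : Fin n, ∑ κ, dirDeriv (totVec a.succ (u a.succ)) (xi Q κ) p • U a.succ κ = 0 := by
  have hU' := h p hp u U hU (by simp [hdiag, hu])
  have h0 := h p hp u 0 (fun _ _ => rfl) (by simp [hu])
  rw [prolAction_eq_add_second_order, h0] at hU'
  have hsymm : ∀ (a : Fin n) κ, U a.succ κ + U κ a.succ = (2 : ℝ) • U a.succ κ := fun a κ => by
    rw [hU κ, two_smul]
  simpa [hdiag, hsymm, dirDeriv_vert_zero, mul_left_comm _ (2 : ℂ), ← Finset.mul_sum] using hU'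

lemma InvariantOn.total_tau_eq_zero (h : InvariantOn M s Q) (hp : p ∈ M) (a : Fin n) (c : ℂ) :
    dirDeriv (totVec a.succ c) (xi Q 0) p = 0 := by
  have hU := h.sum_offdiag_eq_zero hp (u := Fin.cons (Complex.I * (s p * p.2)) fun _ => c)
    (by simp [← mul_assoc])
    (U := fun μ ν => (if μ = a.succ ∧ ν = 0 then 1 else 0) + if μ = 0 ∧ ν = a.succ then 1 else 0)
    (fun μ ν => by simp only [and_comm, add_comm]) (fun b => by simp [Fin.succ_ne_zero])
  simpa [Fin.succ_ne_zero, Fin.sum_univ_succ] using hU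

lemma InvariantOn.killing_offdiag (h : InvariantOn M s Q) (hp : p ∈ M) {a b : Fin n}
    (hab : a ≠ b) : ∂ₓ[a] (xi Q b.succ) p + ∂ₓ[b] (xi Q a.succ) p = 0 := by
  have hU := h.sum_offdiag_eq_zero hp (u := Fin.cons (Complex.I * (s p * p.2)) fun _ => 0)
    (by simp [← mul_assoc])
    (U := fun μ ν => (if μ = a.succ ∧ ν = b.succ then 1 else 0)
      + if μ = b.succ ∧ ν = a.succ then 1 else 0)
    (fun μ ν => by simp only [and_comm, add_comm])
    (fun c => by by_cases h : c = a <;> simp [h, hab])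
  have hsum : ((∂ₓ[a] (xi Q b.succ) p + ∂ₓ[b] (xi Q a.succ) p : ℝ) : ℂ) = 0 := by
    simpa [Fin.succ_ne_zero, Fin.sum_univ_succ, mul_add, Finset.sum_add_distrib, ite_and] using hU
  exact_mod_cast hsum

lemma prolAction_cons_add (hM : IsOpen M)
    (hτ : ∀ q ∈ M, ∀ (a : Fin n) (c : ℂ), dirDeriv (totVec a.succ c) (xi Q 0) q = 0)
    (hτψ : ∀ c, ∂ψ[c] (xi Q 0) p = 0) (hp : p ∈ M) (u₀ w : ℂ) (v : Fin n → ℂ) :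
    prolAction s Q p (Fin.cons (u₀ + w) v) 0 = prolAction s Q p (Fin.cons u₀ v) 0
      + Complex.I * (∂ψ[w] (eta Q) p - ∂ₜ (xi Q 0) p • w
        - ∑ b : Fin n, ∂ψ[w] (xi Q b.succ) p • v b) := by
  have hττ : ∀ (a : Fin n) c,
      dirDeriv (totVec a.succ c) (dirDeriv (totVec a.succ c) (xi Q 0)) p = 0 := fun a c =>
    dirDeriv_eq_zero_of_eqOn_const hM (fun q hq => hτ q hq a c) _ hp
  simp only [prolAction, Fin.cons_zero, Fin.cons_succ, Fin.sum_univ_succ (n := n), Pi.zero_apply,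
    dirDeriv_vert_zero, hττ, dirDeriv_totVec _ 0 u₀,
    dirDeriv_totVec _ 0 (u₀ + w), dirDeriv_vert_add, hτψ, add_zero,
    smul_zero, zero_smul, zero_add, add_smul, smul_add, Finset.sum_add_distrib]
  ring

lemma InvariantOn.second_order_diag (hM : IsOpen M) (h : InvariantOn M s Q)
    (hτψ : ∀ c, ∂ψ[c] (xi Q 0) p = 0) (hp : p ∈ M) (a : Fin n) (v : Fin n → ℂ) (c : ℂ) :
    Complex.I * (∂ψ[Complex.I * c] (eta Q) p - ∂ₜ (xi Q 0) p • (Complex.I * c)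
        - ∑ b : Fin n, ∂ψ[Complex.I * c] (xi Q b.succ) p • v b)
      + (∂ψ[c] (eta Q) p - ∑ b : Fin n, ∂ψ[c] (xi Q b.succ) p • v b)
      - dirDeriv (totVec a.succ (v a)) (xi Q a.succ) p • (2 * c) = 0 := by
  have hbase : Complex.I * (Complex.I * (s p * p.2)) = -(s p * p.2) := by
    rw [← mul_assoc, Complex.I_mul_I, neg_one_mul]
  have h0 := h p hp (Fin.cons (Complex.I * (s p * p.2)) v) 0 (fun _ _ => rfl) (by simp [hbase])
  have hU := h p hp (Fin.cons (Complex.I * (s p * p.2) + Complex.I * c) v)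
    (fun μ ν => if μ = a.succ ∧ ν = a.succ then c else 0) (fun μ ν => by simp only [and_comm])
    (by simp [mul_add, ← mul_assoc])
  rw [prolAction_single, prolAction_cons_add hM
    (fun q hq a c => h.total_tau_eq_zero hq a c) hτψ hp, h0, zero_add] at hU
  simpa [Fin.sum_univ_succ (n := n), hτψ, add_sub_assoc] using hU

end DeterminingEquations

section SymbolEquations

variable {n : ℕ} {M : Set (Base n)} {s : Base n → ℂ} {Q : Base n → Base n} {p : Base n}

/-- The derivative `ζ = η_ψ`. -/
def zeta (Q : Base n → Base n) : Base n → ℂ := ∂ψ[1] (eta Q)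

lemma contDiffOn_zeta (hM : IsOpen M) (hQ : ContDiffOn ℝ ∞ Q M) : ContDiffOn ℝ ∞ (zeta Q) M :=
  contDiffOn_dirDeriv hM (contDiffOn_eta hQ) _

/-- The determining equations that do not involve the potential and come from the terms of the
criterion with second-order jet variables: `Q` projects to a conformal vector field in `(t, x)`, and
`η` is holomorphic in `ψ`. -/
structure SymbolEqns (M : Set (Base n)) (Q : Base n → Base n) : Prop where
  tau_space : ∀ p ∈ M, ∀ a : Fin n, ∂ₓ[a] (xi Q 0) p = 0
  xi_vert : ∀ p ∈ M, ∀ (κ : Fin (n + 1)) (c : ℂ), ∂ψ[c] (xi Q κ) p = 0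
  killing : ∀ p ∈ M, ∀ a b : Fin n,
    ∂ₓ[a] (xi Q b.succ) p + ∂ₓ[b] (xi Q a.succ) p = if a = b then ∂ₜ (xi Q 0) p else 0
  eta_vert : ∀ p ∈ M, ∀ c : ℂ, ∂ψ[c] (eta Q) p = c * zeta Q p

/-- The value of the criterion at a jet with `ψ_a = 0`, once the determining equations
`SymbolEqns` hold. -/
def freeTerm (s : Base n → ℂ) (Q : Base n → Base n) (p : Base n) : ℂ :=
  Complex.I * ∂ₜ (eta Q) p + ∑ b, ∂ₓ[b] (∂ₓ[b] (eta Q)) p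
    + (∂ₜ (xi Q 0) p - zeta Q p) * (s p * p.2) + (dirDeriv (Q p) s p * p.2 + s p * eta Q p)

/-- The determining equations that do not involve the potential. -/
structure PotentialFreeEqns (M : Set (Base n)) (Q : Base n → Base n) : Prop
    extends SymbolEqns M Q where
  zeta_vert : ∀ p ∈ M, ∀ c : ℂ, ∂ψ[c] (zeta Q) p = 0
  zeta_space : ∀ p ∈ M, ∀ a : Fin n, 2 * ∂ₓ[a] (zeta Q) p = Complex.I * ∂ₜ (xi Q a.succ) p

/-- The determining equations of the Lie symmetries of the equation with the potential `s`. -/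
structure DetEqns (M : Set (Base n)) (s : Base n → ℂ) (Q : Base n → Base n) : Prop
    extends PotentialFreeEqns M Q where
  freeTerm_eq_zero : ∀ p ∈ M, freeTerm s Q p = 0

namespace SymbolEqns

lemma dirDeriv_totVec_xi (h : SymbolEqns M Q) (hp : p ∈ M) (μ κ : Fin (n + 1)) (c : ℂ) :
    dirDeriv (totVec μ c) (xi Q κ) p = dirDeriv (coordVec μ) (xi Q κ) p := by
  rw [dirDeriv_totVec, h.xi_vert p hp, add_zero]

/-- As for Killing fields: `∂_c ∂_b ξ^a` is symmetric in `b, c` and antisymmetric in `a, b`. -/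
lemma space_space_xi_succ (hM : IsOpen M) (hQ : ContDiffOn ℝ ∞ Q M) (h : SymbolEqns M Q)
    (hp : p ∈ M) (a b c : Fin n) : ∂ₓ[c] (∂ₓ[b] (xi Q a.succ)) p = 0 := by
  have hsymm := fun a b c : Fin n =>
    dirDeriv_comm hM (contDiffOn_xi hQ a.succ) (coordVec b.succ) (coordVec c.succ) hp
  have hanti : ∀ a b c : Fin n,
      ∂ₓ[c] (∂ₓ[b] (xi Q a.succ)) p + ∂ₓ[c] (∂ₓ[a] (xi Q b.succ)) p = 0 := by
    intro a b c
    have hd : ∀ a b : Fin n, DifferentiableAt ℝ (∂ₓ[b] (xi Q a.succ)) p := fun a b =>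
      differentiableAt_of_contDiffOn hM (contDiffOn_dirDeriv hM (contDiffOn_xi hQ _) _) hp
    rw [← dirDeriv_add (hd a b) (hd b a), dirDeriv_congr hM (fun q hq => h.killing q hq b a) _ hp]
    split_ifs with hab
    · exact dirDeriv_dirDeriv_eq_zero hM (contDiffOn_xi hQ 0) (fun q hq => h.tau_space q hq c) _ hp
    · rw [dirDeriv_const, Pi.zero_apply]
  linarith [hanti a b c, hanti b c a, hanti c a b, hsymm a b c, hsymm b c a, hsymm c a b]

lemma total_total_xi (hM : IsOpen M) (hQ : ContDiffOn ℝ ∞ Q M) (h : SymbolEqns M Q) (hp : p ∈ M)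
    (a : Fin n) (κ : Fin (n + 1)) (c : ℂ) :
    dirDeriv (totVec a.succ c) (dirDeriv (totVec a.succ c) (xi Q κ)) p = 0 := by
  have hspace : ∂ₓ[a] (∂ₓ[a] (xi Q κ)) p = 0 := by
    cases κ using Fin.cases with
    | zero => exact dirDeriv_eq_zero_of_eqOn_const hM (fun q hq => h.tau_space q hq a) _ hp
    | succ b => exact h.space_space_xi_succ hM hQ hp b a a
  rw [dirDeriv_congr hM (fun q hq => h.dirDeriv_totVec_xi hq a.succ κ c) _ hp, dirDeriv_totVec,
    hspace, dirDeriv_dirDeriv_eq_zero hM (contDiffOn_xi hQ κ) (fun q hq => h.xi_vert q hq κ c) _ hp,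
    add_zero]

lemma total_total_eta (hM : IsOpen M) (hQ : ContDiffOn ℝ ∞ Q M) (h : SymbolEqns M Q) (hp : p ∈ M)
    (μ : Fin (n + 1)) (c : ℂ) :
    dirDeriv (totVec μ c) (dirDeriv (totVec μ c) (eta Q)) p
      = dirDeriv (coordVec μ) (dirDeriv (coordVec μ) (eta Q)) p
        + 2 * dirDeriv (coordVec μ) (zeta Q) p * c + c * ∂ψ[c] (zeta Q) p := by
  have hη := contDiffOn_eta hQ
  have hζ := differentiableAt_of_contDiffOn hM (contDiffOn_zeta hM hQ) hp
  have hμ := differentiableAt_of_contDiffOn hM (contDiffOn_dirDeriv hM hη (coordVec μ)) hp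
  have hvert : ∀ v, dirDeriv v (∂ψ[c] (eta Q)) p = c * dirDeriv v (zeta Q) p := fun v => by
    rw [dirDeriv_congr hM (fun q hq => h.eta_vert q hq c) v hp, dirDeriv_const_mul hζ]
  have htot : ∀ q ∈ M, dirDeriv (totVec μ c) (eta Q) q
      = dirDeriv (coordVec μ) (eta Q) q + c * zeta Q q := fun q hq => by
    rw [dirDeriv_totVec, h.eta_vert q hq]
  rw [dirDeriv_congr hM htot _ hp, dirDeriv_add hμ (hζ.const_mul c), dirDeriv_const_mul hζ,
    dirDeriv_totVec _ μ c, dirDeriv_totVec _ μ c,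
    dirDeriv_comm hM hη (vert c) (coordVec μ) hp, hvert]
  ring

lemma sum_space_xi_mul (h : SymbolEqns M Q) (hp : p ∈ M) (U : Fin n → Fin n → ℂ) :
    ∑ a, ∑ b, ∂ₓ[a] (xi Q b.succ) p • (U a b + U b a) = ∂ₜ (xi Q 0) p • ∑ a, U a a := by
  calc ∑ a, ∑ b, ∂ₓ[a] (xi Q b.succ) p • (U a b + U b a)
      = ∑ a, ∑ b, (∂ₓ[a] (xi Q b.succ) p + ∂ₓ[b] (xi Q a.succ) p) • U a b := by
        simp only [smul_add, add_smul, Finset.sum_add_distrib]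
        congr 1
        exact Finset.sum_comm
    _ = ∂ₜ (xi Q 0) p • ∑ a, U a a := by
        simp only [h.killing p hp, ite_smul, zero_smul, Finset.sum_ite_eq, Finset.mem_univ, if_true,
          Finset.smul_sum]

lemma prolAction_eq (hM : IsOpen M) (hQ : ContDiffOn ℝ ∞ Q M) (h : SymbolEqns M Q) (hp : p ∈ M)
    {u : Fin (n + 1) → ℂ} {U : Fin (n + 1) → Fin (n + 1) → ℂ}
    (he : Complex.I * u 0 + ∑ a : Fin n, U a.succ a.succ + s p * p.2 = 0) :
    prolAction s Q p u U = freeTerm s Q p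
      + ∑ a : Fin n, (2 * ∂ₓ[a] (zeta Q) p - Complex.I * ∂ₜ (xi Q a.succ) p) * u a.succ
      + ∑ a : Fin n, u a.succ * ∂ψ[u a.succ] (zeta Q) p := by
  have hU := h.sum_space_xi_mul hp fun a b => U a.succ b.succ
  have hη : dirDeriv (totVec 0 (u 0)) (eta Q) p = ∂ₜ (eta Q) p + u 0 * zeta Q p := by
    rw [dirDeriv_totVec, h.eta_vert p hp]
  have hηη := fun a : Fin n => h.total_total_eta hM hQ hp a.succ (u a.succ)
  have hξ := fun μ κ => h.dirDeriv_totVec_xi hp μ κ (u μ)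
  simp only [prolAction, h.total_total_xi hM hQ hp, hηη, hη, hξ, h.eta_vert p hp, h.xi_vert p hp,
    Fin.sum_univ_succ (n := n), h.tau_space p hp, zero_smul, zero_add, add_zero,
    Finset.sum_add_distrib, Finset.sum_sub_distrib, sub_mul, mul_assoc,
    ← Finset.mul_sum, ← Finset.sum_mul, freeTerm]
  simp only [Complex.real_smul] at hU ⊢
  linear_combination (zeta Q p - (∂ₜ (xi Q 0) p : ℝ)) * he - hU

end SymbolEqns

lemma DetEqns.invariantOn (hM : IsOpen M) (hQ : ContDiffOn ℝ ∞ Q M) (h : DetEqns M s Q) :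
    InvariantOn M s Q := fun p hp u U _ he => by
  rw [h.prolAction_eq hM hQ hp he, h.freeTerm_eq_zero p hp]
  simp [h.zeta_vert p hp, h.zeta_space p hp]

namespace InvariantOn

lemma tau_vert (hn : 1 ≤ n) (h : InvariantOn M s Q) (hp : p ∈ M) (c : ℂ) :
    ∂ψ[c] (xi Q 0) p = 0 := by
  have htot := h.total_tau_eq_zero hp ⟨0, hn⟩
  have hspace : ∂ₓ[⟨0, hn⟩] (xi Q 0) p = 0 := htot 0
  simpa only [dirDeriv_totVec, hspace, zero_add] using htot c

lemma killing_diag_and_eta_vert_I (hn : 1 ≤ n) (hM : IsOpen M) (h : InvariantOn M s Q) (hp : p ∈ M)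
    (a : Fin n) : 2 * ∂ₓ[a] (xi Q a.succ) p = ∂ₜ (xi Q 0) p ∧
      ∂ψ[Complex.I] (eta Q) p = Complex.I * zeta Q p := by
  have hone := h.second_order_diag hM (h.tau_vert hn hp) hp a 0 1
  have hI := h.second_order_diag hM (h.tau_vert hn hp) hp a 0 Complex.I
  rw [Complex.I_mul_I, dirDeriv_vert_eq _ p (-1)] at hI
  simp only [Pi.zero_apply, smul_zero, Finset.sum_const_zero, sub_zero, mul_one, Complex.real_smul,
    Complex.neg_re, Complex.neg_im, Complex.one_re, Complex.one_im, neg_zero, zero_smul, neg_smul,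
    one_smul, add_zero] at hone hI
  have hII := Complex.I_mul_I
  have htrace : ((2 * ∂ₓ[a] (xi Q a.succ) p : ℝ) : ℂ) = (∂ₜ (xi Q 0) p : ℝ) := by
    push_cast
    linear_combination (Complex.I * hI - hone) / 2
      + ((∂ₓ[a] (xi Q a.succ) p : ℝ) - (∂ₜ (xi Q 0) p : ℝ) + ∂ψ[1] (eta Q) p / 2) * hII
  refine ⟨by exact_mod_cast htrace, ?_⟩
  push_cast at htrace
  rw [zeta]
  linear_combination -Complex.I * hone - Complex.I * htrace
    + (∂ψ[Complex.I] (eta Q) p - Complex.I * (∂ₜ (xi Q 0) p : ℝ)) * hII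

lemma eta_vert (hn : 1 ≤ n) (hM : IsOpen M) (h : InvariantOn M s Q) (hp : p ∈ M) (c : ℂ) :
    ∂ψ[c] (eta Q) p = c * zeta Q p := by
  rw [dirDeriv_vert_eq, (h.killing_diag_and_eta_vert_I hn hM hp ⟨0, hn⟩).2, Complex.real_smul,
    Complex.real_smul, ← mul_assoc, zeta, ← add_mul, Complex.re_add_im]

lemma xi_succ_vert (hn : 1 ≤ n) (hM : IsOpen M) (h : InvariantOn M s Q) (hp : p ∈ M) (a : Fin n)
    (c : ℂ) : ∂ψ[c] (xi Q a.succ) p = 0 := by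
  have hdiag := h.second_order_diag hM (h.tau_vert hn hp) hp a (Pi.single a 1) 1
  simp only [← (h.killing_diag_and_eta_vert_I hn hM hp a).1, h.eta_vert hn hM hp, mul_one,
    Pi.single_apply, dirDeriv_totVec _ a.succ 1, smul_ite, smul_zero, Finset.sum_ite_eq',
    Finset.mem_univ, if_true, Complex.real_smul] at hdiag
  have hsplit : ((3 * ∂ψ[1] (xi Q a.succ) p : ℝ) : ℂ)
      + (∂ψ[Complex.I] (xi Q a.succ) p : ℝ) * Complex.I = 0 := by
    push_cast at hdiag ⊢
    linear_combination -hdiag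
      + (zeta Q p - 2 * (∂ₓ[a] (xi Q a.succ) p : ℝ)) * Complex.I_mul_I
  have hre : ∂ψ[1] (xi Q a.succ) p = 0 := by simpa using congrArg Complex.re hsplit
  have him : ∂ψ[Complex.I] (xi Q a.succ) p = 0 := by simpa using congrArg Complex.im hsplit
  rw [dirDeriv_vert_eq, hre, him, smul_zero, smul_zero, add_zero]

lemma symbolEqns (hn : 1 ≤ n) (hM : IsOpen M) (h : InvariantOn M s Q) : SymbolEqns M Q where
  tau_space p hp a := h.total_tau_eq_zero hp a 0
  xi_vert p hp κ c := Fin.cases (h.tau_vert hn hp c) (fun a => h.xi_succ_vert hn hM hp a c) κ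
  killing p hp a b := by
    split_ifs with hab
    · rw [← hab, ← two_mul, (h.killing_diag_and_eta_vert_I hn hM hp a).1]
    · exact h.killing_offdiag hp hab
  eta_vert p hp c := h.eta_vert hn hM hp c

/-- At the jets with `ψ_b = w δ_{ab}` and `ψ_{bc} = 0`, the criterion is a polynomial in the real
scale of `w`; the values `0`, `w` and `-w` separate its coefficients. -/
lemma detEqns (hn : 1 ≤ n) (hM : IsOpen M) (hQ : ContDiffOn ℝ ∞ Q M) (h : InvariantOn M s Q) :
    DetEqns M s Q := by
  have hsymb := h.symbolEqns hn hM
  have hjet : ∀ p ∈ M, ∀ (a : Fin n) (w : ℂ), freeTerm s Q p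
      + (2 * ∂ₓ[a] (zeta Q) p - Complex.I * ∂ₜ (xi Q a.succ) p) * w
      + w * ∂ψ[w] (zeta Q) p = 0 := fun p hp a w => by
    have he : Complex.I * (Complex.I * (s p * p.2)) + s p * p.2 = 0 := by
      rw [← mul_assoc, Complex.I_mul_I, neg_one_mul, neg_add_cancel]
    have hcrit := h p hp (Fin.cons (Complex.I * (s p * p.2)) (Pi.single a w)) 0 (fun _ _ => rfl)
      (by simpa using he)
    rw [hsymb.prolAction_eq hM hQ hp (by simpa using he)] at hcrit
    simpa [Pi.single_apply, Finset.sum_ite_eq'] using hcrit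
  have hfree : ∀ p ∈ M, freeTerm s Q p = 0 := fun p hp => by simpa using hjet p hp ⟨0, hn⟩ 0
  have hvert : ∀ p ∈ M, ∀ c, ∂ψ[c] (zeta Q) p = 0 := fun p hp c => by
    have hneg : ∂ψ[-c] (zeta Q) p = -∂ψ[c] (zeta Q) p := by
      simpa using dirDeriv_smul_vec (zeta Q) (-1) (vert c) p
    have hc := hjet p hp ⟨0, hn⟩ c
    have hc' := hjet p hp ⟨0, hn⟩ (-c)
    rw [hfree p hp] at hc hc'
    rw [hneg] at hc'
    have hprod : c * ∂ψ[c] (zeta Q) p = 0 := by linear_combination (hc + hc') / 2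
    rcases mul_eq_zero.1 hprod with rfl | hc0
    · exact dirDeriv_vert_zero _ _
    · exact hc0
  refine ⟨⟨hsymb, hvert, fun p hp a => ?_⟩, hfree⟩
  have hone := hjet p hp a 1
  rw [hfree p hp, hvert p hp] at hone
  linear_combination hone

end InvariantOn

end SymbolEquations

section Potential

variable {n : ℕ} {Ω : Set ((Fin (n + 1) → ℝ) × ℝ)} {S : (Fin (n + 1) → ℝ) × ℝ → ℂ} {p : Base n}

lemma snd_ne_zero_of_mem_dom (hΩ : IsDomainRho Ω) (hp : p ∈ dom Ω) : p.2 ≠ 0 :=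
  norm_pos_iff.1 (hΩ.rho_pos _ hp)

lemma contDiffOn_potential (hΩ : IsDomainRho Ω) (hS : ContDiffOn ℝ ∞ S Ω) :
    ContDiffOn ℝ ∞ (potential S) (dom Ω) :=
  hS.comp (contDiffOn_fst.prodMk (contDiffOn_snd.norm ℝ fun _ hp => snd_ne_zero_of_mem_dom hΩ hp))
    fun _ hp => hp

lemma dirDeriv_norm_mul {ψ : ℂ} (hψ : ψ ≠ 0) (g : ℂ) :
    dirDeriv (g * ψ) (fun c : ℂ => ‖c‖) ψ = g.re * ‖ψ‖ := by
  have hd : DifferentiableAt ℝ (fun c : ℂ => ‖c‖) ψ := differentiableAt_id.norm ℝ hψ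
  have hsq : dirDeriv (g * ψ) (fun c : ℂ => ‖c‖ * ‖c‖) ψ = 2 * g.re * (‖ψ‖ * ‖ψ‖) :=
    dirDeriv_eq_of_quadratic (R := ‖g * ψ‖ * ‖g * ψ‖) (hd.fun_mul hd) fun t => by
      simp only [Complex.norm_mul_self_eq_normSq, Complex.normSq_apply, Complex.add_re,
        Complex.add_im, Complex.smul_re, Complex.smul_im, Complex.mul_re, Complex.mul_im,
        smul_eq_mul]
      ring
  rw [dirDeriv_mul hd hd] at hsq
  have hnorm : ‖ψ‖ ≠ 0 := norm_ne_zero_iff.2 hψ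
  refine mul_left_cancel₀ hnorm ?_
  linarith

lemma dirDeriv_potential (hΩ : IsDomainRho Ω) (hS : ContDiffOn ℝ ∞ S Ω) (hp : p ∈ dom Ω)
    (w : Fin (n + 1) → ℝ) (g : ℂ) :
    dirDeriv (w, g * p.2) (potential S) p = dirDeriv (w, g.re * ‖p.2‖) S (p.1, ‖p.2‖) := by
  have hψ := snd_ne_zero_of_mem_dom hΩ hp
  have hnorm : HasFDerivAt (fun q : Base n => ‖q.2‖) _ p :=
    HasFDerivAt.comp (g := fun c : ℂ => ‖c‖) p
      (differentiableAt_id.norm ℝ hψ).hasFDerivAt hasFDerivAt_snd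
  have hcomp : HasFDerivAt (potential S) _ p :=
    HasFDerivAt.comp (f := fun q : Base n => (q.1, ‖q.2‖)) p
      (differentiableAt_of_contDiffOn hΩ.isOpen hS hp).hasFDerivAt (hasFDerivAt_fst.prodMk hnorm)
  rw [← dirDeriv_norm_mul hψ, dirDeriv, hcomp.fderiv]
  rfl

/-- The function `ρ S_ρ`, as the derivative of the potential along the radial field. -/
def radial (s : Base n → ℂ) (p : Base n) : ℂ := ∂ψ[p.2] s p

lemma radial_potential (hΩ : IsDomainRho Ω) (hS : ContDiffOn ℝ ∞ S Ω) (hp : p ∈ dom Ω) :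
    radial (potential S) p = ‖p.2‖ * derivRho S (p.1, ‖p.2‖) := by
  have hρ : HasDerivAt (fun r : ℝ => S (p.1, r)) (dirDeriv (0, 1) S (p.1, ‖p.2‖)) ‖p.2‖ :=
    HasFDerivAt.comp_hasDerivAt (f := fun r : ℝ => (p.1, r)) ‖p.2‖
      (differentiableAt_of_contDiffOn hΩ.isOpen hS hp).hasFDerivAt
      ((hasDerivAt_const _ _).prodMk (hasDerivAt_id _))
  have hone := dirDeriv_potential hΩ hS hp 0 1
  rw [Complex.one_re, one_mul, one_mul] at hone
  rw [radial, vert, hone, derivRho, hρ.deriv, ← Complex.real_smul, ← dirDeriv_smul_vec,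
    Prod.smul_mk, smul_zero, smul_eq_mul, mul_one]

lemma dirDeriv_coordVec_potential (hΩ : IsDomainRho Ω) (hS : ContDiffOn ℝ ∞ S Ω) (hp : p ∈ dom Ω)
    (μ : Fin (n + 1)) :
    dirDeriv (coordVec μ) (potential S) p = dirDeriv (Pi.single μ 1, 0) S (p.1, ‖p.2‖) := by
  simpa using dirDeriv_potential hΩ hS hp (Pi.single μ 1) 0

lemma dirDeriv_eq_sum {F : Type*} [NormedAddCommGroup F] [NormedSpace ℝ F] (f : Base n → F)
    (v p : Base n) :
    dirDeriv v f p = ∑ μ, v.1 μ • dirDeriv (coordVec μ) f p + ∂ψ[v.2] f p := by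
  have hv : v = ∑ μ, v.1 μ • coordVec μ + vert v.2 :=
    Prod.ext (by simpa [Prod.fst_sum] using pi_eq_sum_univ' v.1) (by simp [Prod.snd_sum])
  conv_lhs => rw [hv, dirDeriv_add_vec]
  simp only [dirDeriv, map_sum, map_smul]

lemma dirDeriv_vert_potential (hΩ : IsDomainRho Ω) (hS : ContDiffOn ℝ ∞ S Ω) (hp : p ∈ dom Ω)
    (g : ℂ) : ∂ψ[g * p.2] (potential S) p = g.re * radial (potential S) p := by
  have hone := dirDeriv_potential hΩ hS hp 0 1
  rw [Complex.one_re, one_mul, one_mul] at hone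
  rw [radial, vert, dirDeriv_potential hΩ hS hp, vert, hone, ← Complex.real_smul,
    ← dirDeriv_smul_vec, Prod.smul_mk, smul_zero, smul_eq_mul]

/-- Multiplication of `ψ` by `e`. -/
def rotate (e : ℂ) (p : Base n) : Base n := (p.1, e * p.2)

lemma rotate_mem_dom (hp : p ∈ dom Ω) {e : ℂ} (he : ‖e‖ = 1) : rotate e p ∈ dom Ω := by
  simpa [dom, rotate, he] using hp

lemma norm_rotate_snd (p : Base n) {e : ℂ} (he : ‖e‖ = 1) : ‖(rotate e p).2‖ = ‖p.2‖ := by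
  simp [rotate, he]

lemma potential_rotate (S : (Fin (n + 1) → ℝ) × ℝ → ℂ) (p : Base n) {e : ℂ} (he : ‖e‖ = 1) :
    potential S (rotate e p) = potential S p := by
  rw [potential, norm_rotate_snd p he, potential, rotate]

/-- A smooth function on `M` with vanishing derivatives along the fibres `ℂ` of the variable `ψ`. -/
structure FiberConst {F : Type*} [NormedAddCommGroup F] [NormedSpace ℝ F] (M : Set (Base n))
    (f : Base n → F) : Prop where
  smooth : ContDiffOn ℝ ∞ f M
  vert : ∀ p ∈ M, ∀ c : ℂ, ∂ψ[c] f p = 0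

namespace FiberConst

variable {F : Type*} [NormedAddCommGroup F] [NormedSpace ℝ F] {f : Base n → F}

protected lemma dirDeriv {M : Set (Base n)} (hM : IsOpen M) (h : FiberConst M f) (v : Base n) :
    FiberConst M (dirDeriv v f) :=
  ⟨contDiffOn_dirDeriv hM h.smooth v, fun _ hp c =>
    dirDeriv_dirDeriv_eq_zero hM h.smooth (fun q hq => h.vert q hq c) v hp⟩

lemma rotate_eq (hΩ : IsOpen Ω) (h : FiberConst (dom Ω) f) (hp : p ∈ dom Ω) {e : ℂ}
    (he : ‖e‖ = 1) : f (rotate e p) = f p := by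
  have hcircle : ∀ t : ℝ, HasDerivAt (fun t : ℝ => rotate (Complex.exp (t * Complex.I)) p)
      (NLS.vert (Complex.exp (t * Complex.I) * Complex.I * p.2)) t := fun t => by
    refine (hasDerivAt_const t p.1).prodMk (HasDerivAt.mul_const (HasDerivAt.cexp ?_) p.2)
    simpa using (Complex.ofRealCLM.hasDerivAt (x := t)).mul_const Complex.I
  have hderiv : ∀ t : ℝ,
      HasDerivAt (fun t : ℝ => f (rotate (Complex.exp (t * Complex.I)) p)) 0 t := fun t => by
    have hmem := rotate_mem_dom hp (Complex.norm_exp_ofReal_mul_I t)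
    rw [← h.vert _ hmem (Complex.exp (t * Complex.I) * Complex.I * p.2)]
    exact (differentiableAt_of_contDiffOn (isOpen_dom hΩ) h.smooth hmem).hasFDerivAt.comp_hasDerivAt
      t (hcircle t)
  have hexp : Complex.exp (e.arg * Complex.I) = e := by
    simpa [he] using Complex.norm_mul_exp_arg_mul_I e
  simpa [hexp, rotate] using is_const_of_deriv_eq_zero (fun t => (hderiv t).differentiableAt)
    (fun t => (hderiv t).deriv) e.arg 0

end FiberConst

lemma radial_potential_rotate (hΩ : IsDomainRho Ω) (hS : ContDiffOn ℝ ∞ S Ω) (hp : p ∈ dom Ω)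
    {e : ℂ} (he : ‖e‖ = 1) : radial (potential S) (rotate e p) = radial (potential S) p := by
  rw [radial_potential hΩ hS (rotate_mem_dom hp he), norm_rotate_snd p he,
    radial_potential hΩ hS hp, rotate]

lemma dirDeriv_coordVec_potential_rotate (hΩ : IsDomainRho Ω) (hS : ContDiffOn ℝ ∞ S Ω)
    (hp : p ∈ dom Ω) (μ : Fin (n + 1)) {e : ℂ} (he : ‖e‖ = 1) :
    dirDeriv (coordVec μ) (potential S) (rotate e p) = dirDeriv (coordVec μ) (potential S) p := by
  rw [dirDeriv_coordVec_potential hΩ hS (rotate_mem_dom hp he), norm_rotate_snd p he,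
    dirDeriv_coordVec_potential hΩ hS hp, rotate]

end Potential

section ClassifyingEquation

variable {n : ℕ} {M : Set (Base n)} {Ω : Set ((Fin (n + 1) → ℝ) × ℝ)}
  {S : (Fin (n + 1) → ℝ) × ℝ → ℂ} {Q : Base n → Base n} {p : Base n}

/-- The function `η⁰ = η - ζ ψ`. -/
def etaZero (Q : Base n → Base n) (p : Base n) : ℂ := eta Q p - zeta Q p * p.2

/-- The terms `τ_t S + ξ^μ S_μ + (Re ζ) ρ S_ρ` of the classifying equation, where the index `μ`
includes `0`. -/
def potentialVar (s : Base n → ℂ) (Q : Base n → Base n) (p : Base n) : ℂ :=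
  ∂ₜ (xi Q 0) p • s p + ∑ μ, xi Q μ p • dirDeriv (coordVec μ) s p + (zeta Q p).re • radial s p

/-- The left-hand side of the classifying equation. -/
def classifying (s : Base n → ℂ) (Q : Base n → Base n) (p : Base n) : ℂ :=
  Complex.I * ∂ₜ (zeta Q) p + ∑ b, ∂ₓ[b] (∂ₓ[b] (zeta Q)) p + potentialVar s Q p

lemma contDiffOn_etaZero (hM : IsOpen M) (hQ : ContDiffOn ℝ ∞ Q M) :
    ContDiffOn ℝ ∞ (etaZero Q) M :=
  (contDiffOn_eta hQ).sub ((contDiffOn_zeta hM hQ).mul contDiffOn_snd)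

lemma dirDeriv_mul_snd {f : Base n → ℂ} (hf : DifferentiableAt ℝ f p) (v : Base n) :
    dirDeriv v (fun q => f q * q.2) p = dirDeriv v f p * p.2 + f p * v.2 := by
  have hψ : dirDeriv v (fun q : Base n => q.2) p = v.2 :=
    dirDeriv_eq_of_affine differentiableAt_snd fun t => by simp
  rw [dirDeriv_mul hf differentiableAt_snd, hψ]

lemma dirDeriv_coordVec_eta (hM : IsOpen M) (hQ : ContDiffOn ℝ ∞ Q M) (μ : Fin (n + 1))
    (hp : p ∈ M) : dirDeriv (coordVec μ) (eta Q) p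
      = dirDeriv (coordVec μ) (zeta Q) p * p.2 + dirDeriv (coordVec μ) (etaZero Q) p := by
  have hζ := differentiableAt_of_contDiffOn hM (contDiffOn_zeta hM hQ) hp
  have hη₀ := differentiableAt_of_contDiffOn hM (contDiffOn_etaZero hM hQ) hp
  have hη : eta Q = fun q => zeta Q q * q.2 + etaZero Q q := funext fun q => by
    rw [etaZero, add_sub_cancel]
  conv_lhs => rw [hη, dirDeriv_add (hζ.fun_mul differentiableAt_snd) hη₀, dirDeriv_mul_snd hζ,
    mul_zero, add_zero]

lemma dirDeriv_coordVec_dirDeriv_coordVec_eta (hM : IsOpen M) (hQ : ContDiffOn ℝ ∞ Q M)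
    (μ : Fin (n + 1)) (hp : p ∈ M) :
    dirDeriv (coordVec μ) (dirDeriv (coordVec μ) (eta Q)) p
      = dirDeriv (coordVec μ) (dirDeriv (coordVec μ) (zeta Q)) p * p.2
        + dirDeriv (coordVec μ) (dirDeriv (coordVec μ) (etaZero Q)) p := by
  have hζ := differentiableAt_of_contDiffOn hM
    (contDiffOn_dirDeriv hM (contDiffOn_zeta hM hQ) (coordVec μ)) hp
  have hη₀ := differentiableAt_of_contDiffOn hM
    (contDiffOn_dirDeriv hM (contDiffOn_etaZero hM hQ) (coordVec μ)) hp
  rw [dirDeriv_congr hM (fun q hq => dirDeriv_coordVec_eta hM hQ μ hq) _ hp,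
    dirDeriv_add (hζ.fun_mul differentiableAt_snd) hη₀, dirDeriv_mul_snd hζ, mul_zero, add_zero]

lemma freeTerm_potential (hΩ : IsDomainRho Ω) (hS : ContDiffOn ℝ ∞ S Ω)
    (hQ : ContDiffOn ℝ ∞ Q (dom Ω)) (hp : p ∈ dom Ω) :
    freeTerm (potential S) Q p = classifying (potential S) Q p * p.2
      + (Complex.I * ∂ₜ (etaZero Q) p + ∑ b, ∂ₓ[b] (∂ₓ[b] (etaZero Q)) p
        + potential S p * etaZero Q p)
      + (etaZero Q p / p.2).re • (radial (potential S) p * p.2) := by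
  have hM := isOpen_dom hΩ.isOpen
  have hη : (Q p).2 = (zeta Q p + etaZero Q p / p.2) * p.2 := by
    rw [add_mul, div_mul_cancel₀ _ (snd_ne_zero_of_mem_dom hΩ hp), etaZero, add_sub_cancel, eta]
  have hs : dirDeriv (Q p) (potential S) p
      = ∑ μ, xi Q μ p • dirDeriv (coordVec μ) (potential S) p
        + (zeta Q p + etaZero Q p / p.2).re * radial (potential S) p := by
    rw [dirDeriv_eq_sum, hη, dirDeriv_vert_potential hΩ hS hp]
    rfl
  rw [freeTerm, hs, dirDeriv_coordVec_eta hM hQ 0 hp]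
  simp only [dirDeriv_coordVec_dirDeriv_coordVec_eta hM hQ _ hp, Finset.sum_add_distrib,
    ← Finset.sum_mul, classifying, potentialVar, etaZero, Complex.add_re, Complex.ofReal_add,
    Complex.real_smul]
  ring

lemma fiberConst_zeta (hM : IsOpen M) (hQ : ContDiffOn ℝ ∞ Q M) (h : PotentialFreeEqns M Q) :
    FiberConst M (zeta Q) :=
  ⟨contDiffOn_zeta hM hQ, h.zeta_vert⟩

lemma fiberConst_xi (hQ : ContDiffOn ℝ ∞ Q M) (h : SymbolEqns M Q) (μ : Fin (n + 1)) :
    FiberConst M (xi Q μ) :=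
  ⟨contDiffOn_xi hQ μ, fun p hp c => h.xi_vert p hp μ c⟩

lemma fiberConst_etaZero (hM : IsOpen M) (hQ : ContDiffOn ℝ ∞ Q M) (h : PotentialFreeEqns M Q) :
    FiberConst M (etaZero Q) := by
  refine ⟨contDiffOn_etaZero hM hQ, fun p hp c => ?_⟩
  have hζ := differentiableAt_of_contDiffOn hM (contDiffOn_zeta hM hQ) hp
  have hη := differentiableAt_of_contDiffOn hM (contDiffOn_eta hQ) hp
  unfold etaZero
  rw [dirDeriv_sub hη (hζ.fun_mul differentiableAt_snd), dirDeriv_mul_snd hζ, h.eta_vert p hp,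
    h.zeta_vert p hp, zero_mul, zero_add, mul_comm, sub_self]

lemma classifying_rotate (hΩ : IsDomainRho Ω) (hS : ContDiffOn ℝ ∞ S Ω)
    (hQ : ContDiffOn ℝ ∞ Q (dom Ω)) (h : DetEqns (dom Ω) (potential S) Q) (hp : p ∈ dom Ω) {e : ℂ}
    (he : ‖e‖ = 1) :
    classifying (potential S) Q (rotate e p) = classifying (potential S) Q p := by
  have hM := isOpen_dom hΩ.isOpen
  have hζ := fiberConst_zeta hM hQ h.toPotentialFreeEqns
  have hξ := fiberConst_xi hQ h.toSymbolEqns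
  simp only [classifying, potentialVar, hζ.rotate_eq hΩ.isOpen hp he,
    (hζ.dirDeriv hM _).rotate_eq hΩ.isOpen hp he,
    ((hζ.dirDeriv hM _).dirDeriv hM _).rotate_eq hΩ.isOpen hp he,
    (hξ _).rotate_eq hΩ.isOpen hp he, ((hξ _).dirDeriv hM _).rotate_eq hΩ.isOpen hp he,
    potential_rotate S p he, dirDeriv_coordVec_potential_rotate hΩ hS hp _ he,
    radial_potential_rotate hΩ hS hp he]

lemma eq_zero_of_forall_unit {A B R c : ℂ}
    (h : ∀ e : ℂ, ‖e‖ = 1 → e * A + B + (c / e).re • (e * R) = 0) : A = 0 ∧ c * R = 0 := by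
  have h1 := h 1 (by simp)
  have hneg := h (-1) (by simp)
  have hI := h Complex.I (by simp)
  simp only [div_one, one_mul, div_neg, Complex.neg_re, neg_mul, Complex.div_I, Complex.I_re,
    Complex.mul_re, Complex.I_im, Complex.real_smul, Complex.ofReal_neg] at h1 hneg hI
  have hA : A = 0 := by linear_combination (h1 - hneg) / 2
  have hconj : starRingEnd ℂ c * R = 0 := by
    have hc : starRingEnd ℂ c = c.re - c.im * Complex.I := by
      apply Complex.ext <;> simp
    rw [hc]
    simp only [mul_zero, mul_one, zero_sub, Complex.ofReal_neg, neg_mul, neg_neg] at hI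
    linear_combination h1 - hI + (Complex.I - 1) * hA
  refine ⟨hA, ?_⟩
  rcases mul_eq_zero.1 hconj with hc | hR
  · rw [(map_eq_zero _).1 hc, zero_mul]
  · rw [hR, mul_zero]

/-- The criterion is invariant under rotations of `ψ` except for the explicit powers of `ψ`; as
these are different in the three groups of terms of `freeTerm_potential`, the groups separate. -/
lemma DetEqns.classifying_eq_zero_and (hΩ : IsDomainRho Ω) (hS : ContDiffOn ℝ ∞ S Ω)
    (hQ : ContDiffOn ℝ ∞ Q (dom Ω)) (h : DetEqns (dom Ω) (potential S) Q) (hp : p ∈ dom Ω) :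
    classifying (potential S) Q p = 0 ∧ etaZero Q p * radial (potential S) p = 0 := by
  have hM := isOpen_dom hΩ.isOpen
  have hψ := snd_ne_zero_of_mem_dom hΩ hp
  have hη₀ := fiberConst_etaZero hM hQ h.toPotentialFreeEqns
  have hunit := eq_zero_of_forall_unit (A := classifying (potential S) Q p * p.2)
    (B := Complex.I * ∂ₜ (etaZero Q) p + ∑ b, ∂ₓ[b] (∂ₓ[b] (etaZero Q)) p
      + potential S p * etaZero Q p)
    (c := etaZero Q p / p.2) (R := radial (potential S) p * p.2) fun e he => by
      have hmem := rotate_mem_dom hp he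
      have hfree := h.freeTerm_eq_zero _ hmem
      rw [freeTerm_potential hΩ hS hQ hmem, classifying_rotate hΩ hS hQ h hp he] at hfree
      simp only [hη₀.rotate_eq hΩ.isOpen hp he, (hη₀.dirDeriv hM _).rotate_eq hΩ.isOpen hp he,
        ((hη₀.dirDeriv hM _).dirDeriv hM _).rotate_eq hΩ.isOpen hp he,
        potential_rotate S p he, radial_potential_rotate hΩ hS hp he] at hfree
      rw [div_div, mul_comm p.2 e, ← hfree]
      simp only [rotate, Complex.real_smul]
      ring
  refine ⟨(mul_eq_zero.1 hunit.1).resolve_right hψ, ?_⟩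
  rw [← hunit.2]
  field_simp

lemma exists_radial_potential_ne_zero (hΩ : IsDomainRho Ω) (hS : IsClassS Ω S) {U : Set (Base n)}
    (hU : IsOpen U) (hUΩ : U ⊆ dom Ω) (hne : U.Nonempty) :
    ∃ p ∈ U, radial (potential S) p ≠ 0 := by
  obtain ⟨p, hp⟩ := hne
  have hψ := snd_ne_zero_of_mem_dom hΩ (hUΩ hp)
  let ray : (Fin (n + 1) → ℝ) × ℝ → Base n := fun q => (q.1, (q.2 / ‖p.2‖) • p.2)
  have hray : ray (p.1, ‖p.2‖) = p := by simp [ray, hψ]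
  obtain ⟨q, ⟨hqΩ, hqU⟩, hq⟩ := hS.derivRho_ne (Ω ∩ ray ⁻¹' U)
    (hΩ.isOpen.inter (hU.preimage (by fun_prop))) Set.inter_subset_left
    ⟨(p.1, ‖p.2‖), hUΩ hp, by rwa [Set.mem_preimage, hray]⟩
  have hpos := hΩ.rho_pos q hqΩ
  have hnorm : ‖(ray q).2‖ = q.2 := by simp [ray, abs_of_pos hpos, hψ]
  refine ⟨ray q, hqU, ?_⟩
  rw [radial_potential hΩ hS.smooth (hUΩ hqU), hnorm]
  exact mul_ne_zero (by exact_mod_cast hpos.ne') hq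

lemma DetEqns.etaZero_eq_zero (hΩ : IsDomainRho Ω) (hS : IsClassS Ω S)
    (hQ : ContDiffOn ℝ ∞ Q (dom Ω)) (h : DetEqns (dom Ω) (potential S) Q) :
    ∀ p ∈ dom Ω, etaZero Q p = 0 := by
  by_contra! hne
  have hM := isOpen_dom hΩ.isOpen
  obtain ⟨p, ⟨hp, hpne⟩, hr⟩ := exists_radial_potential_ne_zero hΩ hS
    ((contDiffOn_etaZero hM hQ).continuousOn.isOpen_inter_preimage hM isOpen_compl_singleton)
    Set.inter_subset_left hne
  exact mul_ne_zero hpne hr (h.classifying_eq_zero_and hΩ hS.smooth hQ hp).2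

/-- The system that determines `𝔤_S`, where `s` is the function `S(t, x, |ψ|)`; here `etaZero` says
that `η = ζ ψ`. -/
structure ClassifyingSystem (M : Set (Base n)) (s : Base n → ℂ) (Q : Base n → Base n) : Prop
    extends PotentialFreeEqns M Q where
  etaZero_eq_zero : ∀ p ∈ M, etaZero Q p = 0
  classifying_eq_zero : ∀ p ∈ M, classifying s Q p = 0

lemma DetEqns.classifyingSystem (hΩ : IsDomainRho Ω) (hS : IsClassS Ω S)
    (hQ : ContDiffOn ℝ ∞ Q (dom Ω)) (h : DetEqns (dom Ω) (potential S) Q) :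
    ClassifyingSystem (dom Ω) (potential S) Q :=
  ⟨h.toPotentialFreeEqns, h.etaZero_eq_zero hΩ hS hQ,
    fun _ hp => (h.classifying_eq_zero_and hΩ hS.smooth hQ hp).1⟩

lemma ClassifyingSystem.detEqns (hΩ : IsDomainRho Ω) (hS : ContDiffOn ℝ ∞ S Ω)
    (hQ : ContDiffOn ℝ ∞ Q (dom Ω)) (h : ClassifyingSystem (dom Ω) (potential S) Q) :
    DetEqns (dom Ω) (potential S) Q := by
  refine ⟨h.toPotentialFreeEqns, fun p hp => ?_⟩
  have hM := isOpen_dom hΩ.isOpen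
  have hdd : ∀ v w, dirDeriv v (dirDeriv w (etaZero Q)) p = 0 := fun v w =>
    dirDeriv_eq_zero_of_eqOn_const hM
      (fun q hq => dirDeriv_eq_zero_of_eqOn_const hM h.etaZero_eq_zero w hq) v hp
  rw [freeTerm_potential hΩ hS hQ hp, h.classifying_eq_zero p hp, h.etaZero_eq_zero p hp,
    dirDeriv_eq_zero_of_eqOn_const hM h.etaZero_eq_zero _ hp]
  simp [hdd]

lemma mem_lieInvAlg_iff (hn : 1 ≤ n) (hΩ : IsDomainRho Ω) (hS : IsClassS Ω S) :
    Q ∈ lieInvAlg hΩ S ↔ ContDiffOn ℝ ∞ Q (dom Ω) ∧ (∀ p ∉ dom Ω, Q p = 0) ∧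
      ClassifyingSystem (dom Ω) (potential S) Q := by
  have hM := isOpen_dom hΩ.isOpen
  refine and_congr_right fun hQ => and_congr_right fun _ => ?_
  rw [invCriterion_iff_invariantOn hM hQ (contDiffOn_potential hΩ hS.smooth)]
  exact ⟨fun h => (h.detEqns hn hM hQ).classifyingSystem hΩ hS hQ,
    fun h => (h.detEqns hΩ hS.smooth hQ).invariantOn hM hQ⟩

end ClassifyingEquation

section LinearSystemOfCoefficients

variable {n : ℕ} {M : Set (Base n)} {s : Base n → ℂ} {Q : Base n → Base n} {p : Base n}

namespace PotentialFreeEqns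

lemma two_mul_dirDeriv_dirDeriv_zeta (hM : IsOpen M) (hQ : ContDiffOn ℝ ∞ Q M)
    (h : PotentialFreeEqns M Q) (hp : p ∈ M) (a : Fin n) (v : Base n) :
    2 * dirDeriv v (∂ₓ[a] (zeta Q)) p = Complex.I * dirDeriv v (∂ₜ (xi Q a.succ)) p := by
  have hζ := differentiableAt_of_contDiffOn hM
    (contDiffOn_dirDeriv hM (contDiffOn_zeta hM hQ) (coordVec a.succ)) hp
  have hξ := differentiableAt_of_contDiffOn hM
    (contDiffOn_dirDeriv hM (contDiffOn_xi hQ a.succ) (coordVec 0)) hp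
  have hξ' : DifferentiableAt ℝ (fun q => ((∂ₜ (xi Q a.succ) q : ℝ) : ℂ)) p :=
    Complex.ofRealCLM.differentiableAt.comp p hξ
  rw [← dirDeriv_const_mul hζ, dirDeriv_congr hM (fun q hq => h.zeta_space q hq a) v hp,
    dirDeriv_const_mul hξ']
  exact congrArg _ (dirDeriv_clm_comp Complex.ofRealCLM hξ v)

lemma dirDeriv_time_xi_succ (hM : IsOpen M) (hQ : ContDiffOn ℝ ∞ Q M) (h : PotentialFreeEqns M Q)
    (hp : p ∈ M) (a : Fin n) (v : Base n) :
    dirDeriv v (∂ₜ (xi Q a.succ)) p = 2 * (dirDeriv v (∂ₓ[a] (zeta Q)) p).im := by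
  simpa using (congrArg Complex.im (h.two_mul_dirDeriv_dirDeriv_zeta hM hQ hp a v)).symm

/-- Since `∂_t ξ^a` is a multiple of `ζ_a`, the derivative `∂_b ∂_t ξ^a` is symmetric in `a, b`. -/
lemma space_time_xi_succ (hM : IsOpen M) (hQ : ContDiffOn ℝ ∞ Q M) (h : PotentialFreeEqns M Q)
    (hp : p ∈ M) (a b : Fin n) :
    ∂ₓ[b] (∂ₜ (xi Q a.succ)) p = if a = b then ∂ₜ (∂ₜ (xi Q 0)) p / 2 else 0 := by
  have hsymm : ∂ₓ[b] (∂ₜ (xi Q a.succ)) p = ∂ₓ[a] (∂ₜ (xi Q b.succ)) p := by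
    rw [h.dirDeriv_time_xi_succ hM hQ hp, dirDeriv_comm hM (contDiffOn_zeta hM hQ) _ _ hp,
      h.dirDeriv_time_xi_succ hM hQ hp]
  have hsum : ∂ₓ[a] (∂ₜ (xi Q b.succ)) p + ∂ₓ[b] (∂ₜ (xi Q a.succ)) p
      = if a = b then ∂ₜ (∂ₜ (xi Q 0)) p else 0 := by
    have hd : ∀ a b : Fin n, DifferentiableAt ℝ (∂ₓ[b] (xi Q a.succ)) p := fun a b =>
      differentiableAt_of_contDiffOn hM (contDiffOn_dirDeriv hM (contDiffOn_xi hQ _) _) hp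
    rw [dirDeriv_comm hM (contDiffOn_xi hQ b.succ) _ _ hp,
      dirDeriv_comm hM (contDiffOn_xi hQ a.succ) _ _ hp,
      ← dirDeriv_add (hd b a) (hd a b), dirDeriv_congr hM (fun q hq => h.killing q hq a b) _ hp]
    split_ifs with hab
    · rfl
    · rw [dirDeriv_const, Pi.zero_apply]
  split_ifs at hsum ⊢ <;> linarith

lemma space_space_zeta (hM : IsOpen M) (hQ : ContDiffOn ℝ ∞ Q M) (h : PotentialFreeEqns M Q)
    (hp : p ∈ M) (b : Fin n) :
    ∂ₓ[b] (∂ₓ[b] (zeta Q)) p = Complex.I / 4 * ∂ₜ (∂ₜ (xi Q 0)) p := by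
  have hζ := h.two_mul_dirDeriv_dirDeriv_zeta hM hQ hp b (coordVec b.succ)
  rw [h.space_time_xi_succ hM hQ hp, if_pos rfl] at hζ
  push_cast at hζ
  linear_combination hζ / 2

lemma space_time_tau (hM : IsOpen M) (hQ : ContDiffOn ℝ ∞ Q M) (h : PotentialFreeEqns M Q)
    (a : Fin n) (hp : p ∈ M) : ∂ₓ[a] (∂ₜ (xi Q 0)) p = 0 :=
  dirDeriv_dirDeriv_eq_zero hM (contDiffOn_xi hQ 0) (fun q hq => h.tau_space q hq a) _ hp

lemma space_time_time_tau (hM : IsOpen M) (hQ : ContDiffOn ℝ ∞ Q M) (h : PotentialFreeEqns M Q)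
    (a : Fin n) (hp : p ∈ M) : ∂ₓ[a] (∂ₜ (∂ₜ (xi Q 0))) p = 0 :=
  dirDeriv_dirDeriv_eq_zero hM (contDiffOn_dirDeriv hM (contDiffOn_xi hQ 0) _)
    (fun _ => h.space_time_tau hM hQ a) _ hp

lemma time_time_time_tau (hM : IsOpen M) (hQ : ContDiffOn ℝ ∞ Q M) (h : PotentialFreeEqns M Q)
    (a : Fin n) (hp : p ∈ M) :
    ∂ₜ (∂ₜ (∂ₜ (xi Q 0))) p = 2 * ∂ₓ[a] (∂ₜ (∂ₜ (xi Q a.succ))) p := by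
  have hτ := differentiableAt_of_contDiffOn hM
    (contDiffOn_dirDeriv hM (contDiffOn_dirDeriv hM (contDiffOn_xi hQ a.succ)
      (coordVec 0)) (coordVec a.succ)) hp
  rw [dirDeriv_comm hM (contDiffOn_dirDeriv hM (contDiffOn_xi hQ a.succ) _) _ _ hp,
    ← dirDeriv_const_mul hτ]
  refine dirDeriv_congr hM (fun q hq => ?_) _ hp
  rw [h.space_time_xi_succ hM hQ hq, if_pos rfl, mul_div_cancel₀ _ two_ne_zero]

end PotentialFreeEqns

lemma ClassifyingSystem.time_zeta (hM : IsOpen M) (hQ : ContDiffOn ℝ ∞ Q M)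
    (h : ClassifyingSystem M s Q) (hp : p ∈ M) :
    ∂ₜ (zeta Q) p = ∂ₜ (∂ₜ (xi Q 0)) p • (-(n / 4) : ℂ) + Complex.I * potentialVar s Q p := by
  have hW := h.classifying_eq_zero p hp
  simp only [classifying, h.space_space_zeta hM hQ hp, Finset.sum_const, Finset.card_univ,
    Fintype.card_fin, nsmul_eq_mul] at hW
  rw [Complex.real_smul]
  linear_combination -Complex.I * hW +
    (∂ₜ (zeta Q) p + n / 4 * (∂ₜ (∂ₜ (xi Q 0)) p : ℝ)) * Complex.I_sq

/-- The components `ξ`, `ζ`, `∂_t ξ`, `∂_b ξ^a` and `τ_tt`, whose first derivatives are linear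
combinations of the components themselves. -/
def coeffJet (Q : Base n → Base n) (p : Base n) :
    Base n × (Fin (n + 1) → ℝ) × (Fin n → Fin n → ℝ) × ℝ :=
  ((fun μ => xi Q μ p, zeta Q p), fun μ => ∂ₜ (xi Q μ) p, fun a b => ∂ₓ[b] (xi Q a.succ) p,
    ∂ₜ (∂ₜ (xi Q 0)) p)

lemma contDiffOn_coeffJet (hM : IsOpen M) (hQ : ContDiffOn ℝ ∞ Q M) :
    ContDiffOn ℝ ∞ (coeffJet Q) M := by
  have hξ := contDiffOn_xi hQ
  have hξ' := fun v μ => contDiffOn_dirDeriv hM (hξ μ) v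
  exact ((contDiffOn_pi.2 hξ).prodMk (contDiffOn_zeta hM hQ)).prodMk
    ((contDiffOn_pi.2 (hξ' _)).prodMk
      ((contDiffOn_pi.2 fun _ => contDiffOn_pi.2 fun _ => hξ' _ _).prodMk
        (contDiffOn_dirDeriv hM (hξ' _ 0) _)))

lemma coeffJet_congr (hM : IsOpen M) {R : Base n → Base n} (h : Set.EqOn Q R M) :
    Set.EqOn (coeffJet Q) (coeffJet R) M := fun p hp => by
  have hξ : ∀ μ, Set.EqOn (xi Q μ) (xi R μ) M := fun μ q hq => by rw [xi, h hq, xi]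
  have hη : Set.EqOn (eta Q) (eta R) M := fun q hq => by rw [eta, h hq, eta]
  have hdξ := fun μ v => dirDeriv_congr hM (hξ μ) v
  simp only [coeffJet, zeta, hξ _ hp, hdξ _ _ hp, dirDeriv_congr hM hη _ hp,
    dirDeriv_congr hM (hdξ _ _) _ hp]

lemma dirDeriv_coeffJet (hM : IsOpen M) (hQ : ContDiffOn ℝ ∞ Q M) (v : Base n) (hp : p ∈ M) :
    dirDeriv v (coeffJet Q) p = ((fun μ => dirDeriv v (xi Q μ) p, dirDeriv v (zeta Q) p),
      fun μ => dirDeriv v (∂ₜ (xi Q μ)) p, fun a b => dirDeriv v (∂ₓ[b] (xi Q a.succ)) p,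
      dirDeriv v (∂ₜ (∂ₜ (xi Q 0))) p) := by
  have hξ := fun μ => differentiableAt_of_contDiffOn hM (contDiffOn_xi hQ μ) hp
  have hξ' := fun v μ => differentiableAt_of_contDiffOn hM
    (contDiffOn_dirDeriv hM (contDiffOn_xi hQ μ) v) hp
  have hζ := differentiableAt_of_contDiffOn hM (contDiffOn_zeta hM hQ) hp
  have hτ := differentiableAt_of_contDiffOn hM
    (contDiffOn_dirDeriv hM (contDiffOn_dirDeriv hM (contDiffOn_xi hQ 0) (coordVec 0))
      (coordVec 0)) hp
  have hξ₁ : DifferentiableAt ℝ (fun q μ => xi Q μ q) p := differentiableAt_pi.2 hξ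
  have hξ₂ : DifferentiableAt ℝ (fun q μ => ∂ₜ (xi Q μ) q) p := differentiableAt_pi.2 (hξ' _)
  have hξ₃ : ∀ a : Fin n, DifferentiableAt ℝ (fun q b => ∂ₓ[b] (xi Q a.succ) q) p := fun a =>
    differentiableAt_pi.2 fun _ => hξ' _ _
  unfold coeffJet
  rw [dirDeriv_prodMk (hξ₁.prodMk hζ) (hξ₂.prodMk ((differentiableAt_pi.2 hξ₃).prodMk hτ)),
    dirDeriv_prodMk hξ₁ hζ, dirDeriv_prodMk hξ₂ ((differentiableAt_pi.2 hξ₃).prodMk hτ),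
    dirDeriv_prodMk (differentiableAt_pi.2 hξ₃) hτ, dirDeriv_pi hξ, dirDeriv_pi (hξ' _),
    dirDeriv_pi hξ₃]
  simp only [dirDeriv_pi fun _ => hξ' _ _]

lemma contDiffOn_radial (hM : IsOpen M) (hs : ContDiffOn ℝ ∞ s M) : ContDiffOn ℝ ∞ (radial s) M :=
  (hs.fderiv_of_isOpen (m := ∞) hM (by simp)).clm_apply
    (contDiffOn_const.prodMk contDiff_snd.contDiffOn)

lemma smoothLinear_xi (M : Set (Base n)) (Q : Base n → Base n) (μ : Fin (n + 1)) :
    SmoothLinear M (coeffJet Q) (xi Q μ) :=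
  (SmoothLinear.self M (coeffJet Q)).fst.fst.apply μ

lemma smoothLinear_zeta (M : Set (Base n)) (Q : Base n → Base n) :
    SmoothLinear M (coeffJet Q) (zeta Q) :=
  (SmoothLinear.self M (coeffJet Q)).fst.snd

lemma smoothLinear_time_xi (M : Set (Base n)) (Q : Base n → Base n) (μ : Fin (n + 1)) :
    SmoothLinear M (coeffJet Q) (∂ₜ (xi Q μ)) :=
  (SmoothLinear.self M (coeffJet Q)).snd.fst.apply μ

lemma smoothLinear_time_time_tau (M : Set (Base n)) (Q : Base n → Base n) :
    SmoothLinear M (coeffJet Q) (∂ₜ (∂ₜ (xi Q 0))) :=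
  (SmoothLinear.self M (coeffJet Q)).snd.snd.snd

lemma smoothLinear_potentialVar (hM : IsOpen M) (hs : ContDiffOn ℝ ∞ s M) (Q : Base n → Base n) :
    SmoothLinear M (coeffJet Q) (potentialVar s Q) :=
  (((smoothLinear_time_xi M Q 0).smul_right hs).add
    (.sum _ fun μ _ => (smoothLinear_xi M Q μ).smul_right (contDiffOn_dirDeriv hM hs _))).add
    (((smoothLinear_zeta M Q).const_clm Complex.reCLM).smul_right (contDiffOn_radial hM hs))

lemma contDiffOn_potentialVar (hM : IsOpen M) (hs : ContDiffOn ℝ ∞ s M)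
    (hQ : ContDiffOn ℝ ∞ Q M) : ContDiffOn ℝ ∞ (potentialVar s Q) M :=
  (((contDiffOn_dirDeriv hM (contDiffOn_xi hQ 0) _).smul hs).add
    (ContDiffOn.sum fun μ _ => (contDiffOn_xi hQ μ).smul (contDiffOn_dirDeriv hM hs _))).add
    ((Complex.reCLM.contDiff.comp_contDiffOn (contDiffOn_zeta hM hQ)).smul
      (contDiffOn_radial hM hs))

namespace PotentialFreeEqns

lemma vert_potentialVar (hM : IsOpen M) (hs : ContDiffOn ℝ ∞ s M) (hQ : ContDiffOn ℝ ∞ Q M)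
    (h : PotentialFreeEqns M Q) (c : ℂ) (hp : p ∈ M) :
    ∂ψ[c] (potentialVar s Q) p = ∂ₜ (xi Q 0) p • ∂ψ[c] s p
      + ∑ μ, xi Q μ p • ∂ψ[c] (dirDeriv (coordVec μ) s) p
      + (zeta Q p).re • ∂ψ[c] (radial s) p := by
  have hξ := fiberConst_xi hQ h.toSymbolEqns
  have hξd := fun μ => differentiableAt_of_contDiffOn hM (hξ μ).smooth hp
  have hτ := (hξ 0).dirDeriv hM (coordVec 0)
  have hτd := differentiableAt_of_contDiffOn hM hτ.smooth hp
  have hζ := differentiableAt_of_contDiffOn hM (contDiffOn_zeta hM hQ) hp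
  have hre : DifferentiableAt ℝ (fun q => (zeta Q q).re) p :=
    Complex.reCLM.differentiableAt.comp p hζ
  have hre' : ∂ψ[c] (fun q => (zeta Q q).re) p = 0 := by
    rw [← Complex.zero_re, ← h.zeta_vert p hp c]
    exact dirDeriv_clm_comp Complex.reCLM hζ _
  have hsd := differentiableAt_of_contDiffOn hM hs hp
  have hμd := fun μ => differentiableAt_of_contDiffOn hM (contDiffOn_dirDeriv hM hs (coordVec μ)) hp
  have hrd := differentiableAt_of_contDiffOn hM (contDiffOn_radial hM hs) hp
  have hsum := fun μ (_ : μ ∈ Finset.univ) => (hξd μ).fun_smul (hμd μ)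
  unfold potentialVar
  rw [dirDeriv_add ((hτd.fun_smul hsd).fun_add (.fun_sum hsum)) (hre.fun_smul hrd),
    dirDeriv_add (hτd.fun_smul hsd) (.fun_sum hsum), dirDeriv_sum hsum, dirDeriv_smul hτd hsd,
    dirDeriv_smul hre hrd, hre', hτ.vert p hp]
  simp only [dirDeriv_smul (hξd _) (hμd _), (hξ _).vert p hp, zero_smul, zero_add]

lemma smoothLinear_space_time_xi_succ (hM : IsOpen M) (hQ : ContDiffOn ℝ ∞ Q M)
    (h : PotentialFreeEqns M Q) (a b : Fin n) :
    SmoothLinear M (coeffJet Q) (∂ₓ[b] (∂ₜ (xi Q a.succ))) :=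
  ((smoothLinear_time_time_tau M Q).const_smul (if a = b then 1 / 2 else 0)).congr fun p hp => by
    rw [h.space_time_xi_succ hM hQ hp]
    split_ifs <;> simp [div_eq_inv_mul]

lemma smoothLinear_space_coeffJet (hM : IsOpen M) (hQ : ContDiffOn ℝ ∞ Q M)
    (h : PotentialFreeEqns M Q) (b : Fin n) :
    SmoothLinear M (coeffJet Q) (∂ₓ[b] (coeffJet Q)) := by
  have hξ : ∀ μ, SmoothLinear M (coeffJet Q) (∂ₓ[b] (xi Q μ)) := Fin.cases
    (.of_eq_zero fun p hp => h.tau_space p hp b)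
    fun a => ((SmoothLinear.self M (coeffJet Q)).snd.snd.fst.apply a).apply b
  have hζ : SmoothLinear M (coeffJet Q) (∂ₓ[b] (zeta Q)) :=
    ((smoothLinear_time_xi M Q b.succ).smul_right (f := fun _ => Complex.I / 2)
      contDiffOn_const).congr fun p hp => by
        simp only [Complex.real_smul]
        linear_combination h.zeta_space p hp b / 2
  have hξt : ∀ μ, SmoothLinear M (coeffJet Q) (∂ₓ[b] (∂ₜ (xi Q μ))) := Fin.cases
    (.of_eq_zero fun p hp => h.space_time_tau hM hQ b hp)
    fun a => h.smoothLinear_space_time_xi_succ hM hQ a b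
  exact (((SmoothLinear.pi hξ).prodMk hζ).prodMk ((SmoothLinear.pi hξt).prodMk
    ((SmoothLinear.of_eq_zero (f := fun p a c => ∂ₓ[b] (∂ₓ[c] (xi Q a.succ)) p)
      fun p hp => funext₂ fun a c => h.space_space_xi_succ hM hQ hp a c b).prodMk
        (.of_eq_zero fun p hp => h.space_time_time_tau hM hQ b hp)))).congr
          fun p hp => dirDeriv_coeffJet hM hQ _ hp

lemma vert_coeffJet (hM : IsOpen M) (hQ : ContDiffOn ℝ ∞ Q M) (h : PotentialFreeEqns M Q) (c : ℂ)
    (hp : p ∈ M) : ∂ψ[c] (coeffJet Q) p = 0 := by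
  have hξ := fiberConst_xi hQ h.toSymbolEqns
  rw [dirDeriv_coeffJet hM hQ _ hp]
  simp only [(hξ _).vert p hp, ((hξ _).dirDeriv hM _).vert p hp, h.zeta_vert p hp,
    (((hξ _).dirDeriv hM _).dirDeriv hM _).vert p hp]
  rfl

end PotentialFreeEqns

namespace ClassifyingSystem

lemma smoothLinear_time_coeffJet (hn : 1 ≤ n) (hM : IsOpen M) (hs : ContDiffOn ℝ ∞ s M)
    (hQ : ContDiffOn ℝ ∞ Q M) (h : ClassifyingSystem M s Q) :
    SmoothLinear M (coeffJet Q) (∂ₜ (coeffJet Q)) := by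
  have hspace : ∀ {F : Type} [NormedAddCommGroup F] [NormedSpace ℝ F] {f : Base n → F} (b : Fin n),
      SmoothLinear M (coeffJet Q) f → SmoothLinear M (coeffJet Q) (∂ₓ[b] f) := fun b hf =>
    (h.smoothLinear_space_coeffJet hM hQ b).dirDeriv hM (contDiffOn_coeffJet hM hQ) hf
  have hτ := smoothLinear_time_time_tau M Q
  have hζ : SmoothLinear M (coeffJet Q) (∂ₜ (zeta Q)) :=
    ((hτ.smul_right contDiffOn_const).add ((smoothLinear_potentialVar hM hs Q).const_clm
      (ContinuousLinearMap.mul ℝ ℂ Complex.I))).congr fun p hp => h.time_zeta hM hQ hp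
  have hξt : ∀ a : Fin n, SmoothLinear M (coeffJet Q) (∂ₜ (∂ₜ (xi Q a.succ))) := fun a =>
    (((hspace a hζ).const_clm Complex.imCLM).const_smul 2).congr fun p hp => by
      rw [h.dirDeriv_time_xi_succ hM hQ hp, dirDeriv_comm hM (contDiffOn_zeta hM hQ) _ _ hp]
      rfl
  have hξx : ∀ a b : Fin n, SmoothLinear M (coeffJet Q) (∂ₜ (∂ₓ[b] (xi Q a.succ))) := fun a b =>
    (h.smoothLinear_space_time_xi_succ hM hQ a b).congr (dirDeriv_comm hM (contDiffOn_xi hQ _) _ _)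
  have hτtt : SmoothLinear M (coeffJet Q) (∂ₜ (∂ₜ (∂ₜ (xi Q 0)))) :=
    ((hspace ⟨0, hn⟩ (hξt ⟨0, hn⟩)).const_smul 2).congr fun p hp =>
      h.time_time_time_tau hM hQ ⟨0, hn⟩ hp
  exact (((SmoothLinear.pi (smoothLinear_time_xi M Q)).prodMk hζ).prodMk
    ((SmoothLinear.pi (Fin.cases hτ hξt)).prodMk
      ((SmoothLinear.pi fun a => .pi (hξx a)).prodMk hτtt))).congr
        fun p hp => dirDeriv_coeffJet hM hQ _ hp

lemma smoothLinear_dirDeriv_coeffJet (hn : 1 ≤ n) (hM : IsOpen M) (hs : ContDiffOn ℝ ∞ s M)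
    (hQ : ContDiffOn ℝ ∞ Q M) (h : ClassifyingSystem M s Q) (v : Base n) :
    SmoothLinear M (coeffJet Q) (dirDeriv v (coeffJet Q)) := by
  have hcoord : ∀ μ, SmoothLinear M (coeffJet Q) (dirDeriv (coordVec μ) (coeffJet Q)) := Fin.cases
    (h.smoothLinear_time_coeffJet hn hM hs hQ) (h.smoothLinear_space_coeffJet hM hQ)
  refine (SmoothLinear.sum Finset.univ fun μ _ => (hcoord μ).const_smul (v.1 μ)).congr
    fun p hp => ?_
  rw [dirDeriv_eq_sum, h.vert_coeffJet hM hQ _ hp, add_zero]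

lemma eq_zero_of_coeffJet_eq_zero (hn : 1 ≤ n) (hM : IsOpen M) (hc : IsPreconnected M)
    (hs : ContDiffOn ℝ ∞ s M) (hQ : ContDiffOn ℝ ∞ Q M) (h : ClassifyingSystem M s Q)
    {p₀ : Base n} (hp₀ : p₀ ∈ M) (h0 : coeffJet Q p₀ = 0) (hp : p ∈ M) : Q p = 0 := by
  have hzero := eq_zero_of_closed_linear_system hM hc (contDiffOn_coeffJet hM hQ)
    (h.smoothLinear_dirDeriv_coeffJet hn hM hs hQ) hp₀ h0 p hp
  have hη : eta Q p = zeta Q p * p.2 := sub_eq_zero.1 (h.etaZero_eq_zero p hp)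
  have hζ : zeta Q p = 0 := congrArg (fun d => d.1.2) hzero
  refine Prod.ext (congrArg (fun d => d.1.1) hzero) ?_
  rw [← eta, hη, hζ, zero_mul]
  rfl

lemma vert_potentialVar_eq_zero (hM : IsOpen M) (hs : ContDiffOn ℝ ∞ s M)
    (hQ : ContDiffOn ℝ ∞ Q M) (h : ClassifyingSystem M s Q) (c : ℂ) (hp : p ∈ M) :
    ∂ψ[c] (potentialVar s Q) p = 0 := by
  have hζ := fiberConst_zeta hM hQ h.toPotentialFreeEqns
  have hξ := fiberConst_xi hQ h.toSymbolEqns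
  have hτ := differentiableAt_of_contDiffOn hM (((hξ 0).dirDeriv hM (coordVec 0)).dirDeriv hM
    (coordVec 0)).smooth hp
  have hW := differentiableAt_of_contDiffOn hM (contDiffOn_potentialVar hM hs hQ) hp
  have htime := dirDeriv_congr hM (fun q hq => h.time_zeta hM hQ hq) (vert c) hp
  rw [(hζ.dirDeriv hM _).vert p hp, dirDeriv_add (hτ.fun_smul (differentiableAt_const _))
    (hW.const_mul _), dirDeriv_smul hτ (differentiableAt_const _), dirDeriv_const,
    (((hξ 0).dirDeriv hM _).dirDeriv hM _).vert p hp, dirDeriv_const_mul hW] at htime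
  simpa using htime

/-- The derivative of the classifying equation along the radial field, at a point where all its
terms that involve the potential vanish except for `τ_t S`. -/
lemma time_tau_eq_zero (hM : IsOpen M) (hs : ContDiffOn ℝ ∞ s M) (hQ : ContDiffOn ℝ ∞ Q M)
    (h : ClassifyingSystem M s Q) (hp : p ∈ M) (hξ : ∀ μ, xi Q μ p = 0) (hζ : (zeta Q p).re = 0)
    (hr : radial s p ≠ 0) : ∂ₜ (xi Q 0) p = 0 := by
  have hW := h.vert_potentialVar hM hs hQ p.2 hp
  rw [h.vert_potentialVar_eq_zero hM hs hQ _ hp] at hW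
  simp only [hξ, hζ, zero_smul, Finset.sum_const_zero, add_zero] at hW
  exact (smul_eq_zero.1 hW.symm).resolve_right hr

end ClassifyingSystem

end LinearSystemOfCoefficients

section UpperBound

variable {n : ℕ} {M : Set (Base n)} {Ω : Set ((Fin (n + 1) → ℝ) × ℝ)}
  {S : (Fin (n + 1) → ℝ) × ℝ → ℂ} {Q R : Base n → Base n} {p p₀ : Base n}

lemma isPreconnected_dom (hΩ : IsDomainRho Ω) : IsPreconnected (dom Ω) := by
  have hpolar : dom Ω = (fun q : ((Fin (n + 1) → ℝ) × ℝ) × ℝ =>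
      ((q.1.1, q.1.2 * Complex.exp (q.2 * Complex.I)) : Base n)) '' (Ω ×ˢ Set.univ) := by
    refine Set.Subset.antisymm (fun p hp => ⟨((p.1, ‖p.2‖), p.2.arg), ⟨hp, trivial⟩,
      Prod.ext rfl (Complex.norm_mul_exp_arg_mul_I p.2)⟩) ?_
    rintro _ ⟨q, ⟨hq, -⟩, rfl⟩
    have hnorm : ‖(q.1.2 : ℂ) * Complex.exp (q.2 * Complex.I)‖ = q.1.2 := by
      simp [Complex.norm_exp_ofReal_mul_I, abs_of_pos (hΩ.rho_pos _ hq)]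
    simpa only [dom, Set.mem_ofPred_eq, hnorm] using hq
  rw [hpolar]
  exact (hΩ.isConnected.isPreconnected.prod isPreconnected_univ).image _ (by fun_prop)

lemma nonempty_dom (hΩ : IsDomainRho Ω) : (dom Ω).Nonempty := by
  obtain ⟨q, hq⟩ := hΩ.isConnected.nonempty
  refine ⟨(q.1, (q.2 : ℂ)), ?_⟩
  have hnorm : ‖((q.2 : ℝ) : ℂ)‖ = q.2 := by simp [abs_of_pos (hΩ.rho_pos q hq)]
  simpa only [dom, Set.mem_ofPred_eq, hnorm] using hq

/-- The pairs `(a, b)` of indices with `b < a`. -/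
abbrev LowerPairs (n : ℕ) : Type := (a : Fin n) × Fin a

/-- The entry of a matrix at a pair of indices `(a, b)` with `b < a`. -/
def lowerEntry (r : Fin n → Fin n → ℝ) (k : LowerPairs n) : ℝ := r k.1 (k.2.castLE k.1.2.le)

/-- The space of the values of `(ξ, ζ)`, `∂_t ξ^a`, `τ_tt` and `∂_b ξ^a` with `b < a` at a point. -/
abbrev JetData (n : ℕ) : Type := Base n × (Fin n → ℝ) × ℝ × (LowerPairs n → ℝ)

lemma card_lowerPairs (n : ℕ) : Fintype.card (LowerPairs n) = n * (n - 1) / 2 := by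
  simp only [Fintype.card_sigma, Fintype.card_fin]
  rw [Fin.sum_univ_eq_sum_range (fun i => i) n, Finset.sum_range_id]

lemma finrank_jetData (n : ℕ) : Module.finrank ℝ (JetData n) = n * (n + 3) / 2 + 4 := by
  simp only [Module.finrank_prod, Module.finrank_fintype_fun_eq_card, Fintype.card_fin,
    Complex.finrank_real_complex, Module.finrank_self, card_lowerPairs]
  have hsplit : n * (n + 3) = n * (n - 1) + 4 * n := by
    cases n with
    | zero => rfl
    | succ n => rw [Nat.add_sub_cancel]; ring
  omega

lemma coeffJet_add (hM : IsOpen M) (hQ : ContDiffOn ℝ ∞ Q M) (hR : ContDiffOn ℝ ∞ R M)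
    (hp : p ∈ M) : coeffJet (Q + R) p = coeffJet Q p + coeffJet R p := by
  have hadd : ∀ {F : Type} [NormedAddCommGroup F] [NormedSpace ℝ F] {f g : Base n → F},
      ContDiffOn ℝ ∞ f M → ContDiffOn ℝ ∞ g M → ∀ v,
        Set.EqOn (dirDeriv v fun q => f q + g q) (fun q => dirDeriv v f q + dirDeriv v g q) M :=
    fun hf hg v q hq => dirDeriv_add (differentiableAt_of_contDiffOn hM hf hq)
      (differentiableAt_of_contDiffOn hM hg hq) v
  have hξ := fun v μ => hadd (contDiffOn_xi hQ μ) (contDiffOn_xi hR μ) v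
  have hτtt : ∂ₜ (∂ₜ (xi (Q + R) 0)) p = ∂ₜ (∂ₜ (xi Q 0)) p + ∂ₜ (∂ₜ (xi R 0)) p :=
    (dirDeriv_congr hM (hξ _ 0) _ hp).trans
      (hadd (contDiffOn_dirDeriv hM (contDiffOn_xi hQ 0) _)
        (contDiffOn_dirDeriv hM (contDiffOn_xi hR 0) _) _ hp)
  exact Prod.ext (Prod.ext rfl (hadd (contDiffOn_eta hQ) (contDiffOn_eta hR) _ hp))
    (Prod.ext (funext fun μ => hξ _ μ hp)
      (Prod.ext (funext₂ fun a b => hξ _ a.succ hp) hτtt))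

lemma coeffJet_smul (c : ℝ) (Q : Base n → Base n) (p : Base n) :
    coeffJet (c • Q) p = c • coeffJet Q p := by
  have hξ : ∀ μ, xi (c • Q) μ = c • xi Q μ := fun _ => rfl
  have hη : eta (c • Q) = c • eta Q := rfl
  simp only [coeffJet, zeta, hξ, hη, dirDeriv_const_smul]
  rfl

/-- The map `Q ↦ coeffJet Q p₀` on the algebra. -/
def coeffJetMap (hΩ : IsDomainRho Ω) (S : (Fin (n + 1) → ℝ) × ℝ → ℂ) (hp₀ : p₀ ∈ dom Ω) :
    lieInvAlg hΩ S →ₗ[ℝ] Base n × (Fin (n + 1) → ℝ) × (Fin n → Fin n → ℝ) × ℝ where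
  toFun Q := coeffJet Q.1 p₀
  map_add' Q R := coeffJet_add (isOpen_dom hΩ.isOpen) Q.2.1 R.2.1 hp₀
  map_smul' c Q := coeffJet_smul c Q.1 p₀

/-- The projection from the values of `coeffJet` onto the data that determine a vector field of the
algebra. -/
def jetDataMap (n : ℕ) :
    Base n × (Fin (n + 1) → ℝ) × (Fin n → Fin n → ℝ) × ℝ →ₗ[ℝ] JetData n where
  toFun y := (y.1, fun a => y.2.1 a.succ, y.2.2.2, lowerEntry y.2.2.1)
  map_add' _ _ := rfl
  map_smul' _ _ := rfl

lemma eq_zero_of_jetDataMap_eq_zero (hn : 1 ≤ n) (hM : IsOpen M) (hc : IsPreconnected M)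
    {s : Base n → ℂ} (hs : ContDiffOn ℝ ∞ s M) (hQ : ContDiffOn ℝ ∞ Q M)
    (h : ClassifyingSystem M s Q)
    (hp₀ : p₀ ∈ M) (hr : radial s p₀ ≠ 0) (h0 : jetDataMap n (coeffJet Q p₀) = 0) (hp : p ∈ M) :
    Q p = 0 := by
  have hξζ : ((fun μ => xi Q μ p₀, zeta Q p₀) : Base n) = 0 := congrArg (fun d => d.1) h0
  have hξ : ∀ μ, xi Q μ p₀ = 0 := congrFun (congrArg Prod.fst hξζ)
  have hξt : ∀ a : Fin n, ∂ₜ (xi Q a.succ) p₀ = 0 := congrFun (congrArg (fun d => d.2.1) h0)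
  have hτtt : ∂ₜ (∂ₜ (xi Q 0)) p₀ = 0 := congrArg (fun d => d.2.2.1) h0
  have hlower : ∀ a b : Fin n, b < a → ∂ₓ[b] (xi Q a.succ) p₀ = 0 := fun a b hab =>
    congrFun (congrArg (fun d => d.2.2.2) h0) ⟨a, ⟨b, hab⟩⟩
  have hτ : ∂ₜ (xi Q 0) p₀ = 0 := h.time_tau_eq_zero hM hs hQ hp₀ hξ
    (congrArg (fun d => d.2.re) hξζ) hr
  have hξx : ∀ a b : Fin n, ∂ₓ[b] (xi Q a.succ) p₀ = 0 := by
    intro a b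
    have hk := h.killing p₀ hp₀ a b
    rw [hτ, ite_self] at hk
    rcases lt_trichotomy a b with hab | rfl | hab
    · linarith [hlower b a hab]
    · linarith
    · exact hlower a b hab
  have hξt' : ∀ μ, ∂ₜ (xi Q μ) p₀ = 0 := Fin.cases hτ hξt
  refine h.eq_zero_of_coeffJet_eq_zero hn hM hc hs hQ hp₀ ?_ hp
  rw [coeffJet, hξζ, funext hξt', funext₂ hξx, hτtt]
  rfl

lemma jetDataMap_comp_coeffJetMap_injective (hn : 1 ≤ n) (hΩ : IsDomainRho Ω) (hS : IsClassS Ω S)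
    (hp₀ : p₀ ∈ dom Ω) (hr : radial (potential S) p₀ ≠ 0) :
    Function.Injective (jetDataMap n ∘ₗ coeffJetMap hΩ S hp₀) := by
  rw [← LinearMap.ker_eq_bot, LinearMap.ker_eq_bot']
  rintro ⟨Q, hQmem⟩ h0
  obtain ⟨hQ, hQ0, hsys⟩ := (mem_lieInvAlg_iff hn hΩ hS).1 hQmem
  refine Subtype.ext (funext fun p => ?_)
  by_cases hp : p ∈ dom Ω
  · exact eq_zero_of_jetDataMap_eq_zero hn (isOpen_dom hΩ.isOpen) (isPreconnected_dom hΩ)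
      (contDiffOn_potential hΩ hS.smooth) hQ hsys hp₀ hr h0 hp
  · exact hQ0 p hp

lemma finite_and_finrank_lieInvAlg_le (hn : 1 ≤ n) (hΩ : IsDomainRho Ω) (hS : IsClassS Ω S) :
    Module.Finite ℝ (lieInvAlg hΩ S) ∧
      Module.finrank ℝ (lieInvAlg hΩ S) ≤ n * (n + 3) / 2 + 4 := by
  obtain ⟨p₀, hp₀, hr⟩ := exists_radial_potential_ne_zero hΩ hS (isOpen_dom hΩ.isOpen) subset_rfl
    (nonempty_dom hΩ)
  have hinj := jetDataMap_comp_coeffJetMap_injective hn hΩ hS hp₀ hr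
  refine ⟨Module.Finite.of_injective _ hinj, ?_⟩
  rw [← finrank_jetData]
  exact LinearMap.finrank_le_finrank_of_injective hinj

end UpperBound

section CriticalPower

variable {n : ℕ} {Ω : Set ((Fin (n + 1) → ℝ) × ℝ)} {p : Base n}

lemma contDiffOn_powerS (hΩ : IsDomainRho Ω) : ContDiffOn ℝ ∞ (powerS n) Ω := fun q hq =>
  (Complex.ofRealCLM.contDiff.contDiffAt.comp q
    (contDiffAt_snd.rpow_const_of_ne (hΩ.rho_pos q hq).ne')).contDiffWithinAt

lemma derivRho_powerS {q : (Fin (n + 1) → ℝ) × ℝ} (hq : 0 < q.2) :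
    derivRho (powerS n) q = ((4 / n * q.2 ^ (4 / (n : ℝ) - 1) : ℝ) : ℂ) :=
  (Real.hasDerivAt_rpow_const (p := 4 / (n : ℝ)) (Or.inl hq.ne')).ofReal_comp.deriv

lemma isClassS_powerS (hn : 1 ≤ n) (hΩ : IsDomainRho Ω) : IsClassS Ω (powerS n) := by
  refine ⟨contDiffOn_powerS hΩ, fun U _ hU ⟨q, hq⟩ => ⟨q, hq, ?_⟩⟩
  have hpos := hΩ.rho_pos q (hU hq)
  have : (0 : ℝ) < n := by exact_mod_cast hn
  rw [derivRho_powerS hpos, Complex.ofReal_ne_zero]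
  positivity

lemma radial_powerS (hΩ : IsDomainRho Ω) (hp : p ∈ dom Ω) :
    radial (potential (powerS n)) p = 4 / n * potential (powerS n) p := by
  have hpos : 0 < ‖p.2‖ := hΩ.rho_pos _ hp
  have hpow : ‖p.2‖ ^ (4 / (n : ℝ)) = ‖p.2‖ * ‖p.2‖ ^ (4 / (n : ℝ) - 1) := by
    rw [Real.rpow_sub_one hpos.ne', mul_div_cancel₀ _ hpos.ne']
  rw [radial_potential hΩ (contDiffOn_powerS hΩ) hp, derivRho_powerS hpos, potential, powerS, hpow]
  push_cast
  ring

lemma dirDeriv_coordVec_potential_powerS (hΩ : IsDomainRho Ω) (hp : p ∈ dom Ω)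
    (μ : Fin (n + 1)) : dirDeriv (coordVec μ) (potential (powerS n)) p = 0 :=
  dirDeriv_eq_of_affine (differentiableAt_of_contDiffOn (isOpen_dom hΩ.isOpen)
    (contDiffOn_potential hΩ (contDiffOn_powerS hΩ)) hp) fun t => by simp [potential, powerS]

/-- The parameters of an infinitesimal symmetry of the equation with the critical power
nonlinearity: its components along the translations of `(t, x)`, the scaling, the Galilean boosts,
the (pseudo-)conformal inversion, the rotations and the phase shift. -/
structure CriticalSymmetry (n : ℕ) where
  shift : Fin (n + 1) → ℝ
  scaling : ℝ
  boost : Fin n → ℝ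
  inversion : ℝ
  rotation : Fin n → Fin n → ℝ
  rotation_add_rotation : ∀ a b, rotation a b + rotation b a = 0
  phase : ℝ

namespace CriticalSymmetry

variable (g : CriticalSymmetry n) (z₀ : Fin (n + 1) → ℝ)

/-- The derivative `τ_t` of the symmetry centred at `z₀`. -/
def rate (p : Base n) : ℝ := g.scaling + g.inversion * (p.1 0 - z₀ 0)

/-- The coefficient `τ` of the symmetry centred at `z₀`. -/
def tau (p : Base n) : ℝ :=
  g.shift 0 + g.scaling * (p.1 0 - z₀ 0) + g.inversion / 2 * (p.1 0 - z₀ 0) ^ 2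

/-- The coefficient `ξ^a` of the symmetry centred at `z₀`. -/
def space (a : Fin n) (p : Base n) : ℝ :=
  g.shift a.succ + g.rate z₀ p / 2 * (p.1 a.succ - z₀ a.succ) + g.boost a * (p.1 0 - z₀ 0)
    + ∑ b, g.rotation a b * (p.1 b.succ - z₀ b.succ)

/-- The imaginary part of the coefficient `ζ` of the symmetry centred at `z₀`. -/
def phaseRate (p : Base n) : ℝ :=
  g.phase + ∑ b, (g.inversion / 8 * (p.1 b.succ - z₀ b.succ) ^ 2
    + g.boost b / 2 * (p.1 b.succ - z₀ b.succ))

/-- The coefficient `ζ` of the symmetry centred at `z₀`. -/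
def multiplier (p : Base n) : ℂ :=
  Complex.I * (g.phaseRate z₀ p : ℝ) - n / 4 * (g.rate z₀ p : ℝ)

/-- The vector field of the symmetry centred at `z₀`. -/
def field (p : Base n) : Base n :=
  (Fin.cons (g.tau z₀ p) fun a => g.space z₀ a p, g.multiplier z₀ p * p.2)

lemma contDiff_rate : ContDiff ℝ ∞ (g.rate z₀) := by
  unfold rate
  fun_prop

lemma contDiff_tau : ContDiff ℝ ∞ (g.tau z₀) := by
  unfold tau
  fun_prop

lemma contDiff_space (a : Fin n) : ContDiff ℝ ∞ (g.space z₀ a) := by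
  unfold space rate
  fun_prop

lemma contDiff_phaseRate : ContDiff ℝ ∞ (g.phaseRate z₀) := by
  unfold phaseRate
  fun_prop

lemma contDiff_multiplier : ContDiff ℝ ∞ (g.multiplier z₀) :=
  (contDiff_const.mul (Complex.ofRealCLM.contDiff.comp (g.contDiff_phaseRate z₀))).sub
    (contDiff_const.mul (Complex.ofRealCLM.contDiff.comp (g.contDiff_rate z₀)))

lemma contDiff_field : ContDiff ℝ ∞ (g.field z₀) :=
  (contDiff_pi.2 (Fin.cases (g.contDiff_tau z₀) (g.contDiff_space z₀))).prodMk
    ((g.contDiff_multiplier z₀).mul contDiff_snd)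

lemma dirDeriv_rate (v p : Base n) : dirDeriv v (g.rate z₀) p = g.inversion * v.1 0 :=
  dirDeriv_eq_of_affine ((g.contDiff_rate z₀).differentiable (by simp) p) fun t => by
    simp only [rate, Prod.fst_add, Prod.smul_fst, Pi.add_apply, Pi.smul_apply, smul_eq_mul]
    ring

lemma dirDeriv_tau (v p : Base n) : dirDeriv v (g.tau z₀) p = g.rate z₀ p * v.1 0 :=
  dirDeriv_eq_of_quadratic (R := g.inversion / 2 * v.1 0 ^ 2)
    ((g.contDiff_tau z₀).differentiable (by simp) p) fun t => by
      simp only [tau, rate, Prod.fst_add, Prod.smul_fst, Pi.add_apply, Pi.smul_apply, smul_eq_mul]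
      ring

lemma dirDeriv_space (a : Fin n) (v p : Base n) :
    dirDeriv v (g.space z₀ a) p
      = (g.inversion / 2 * (p.1 a.succ - z₀ a.succ) + g.boost a) * v.1 0
        + g.rate z₀ p / 2 * v.1 a.succ + ∑ b, g.rotation a b * v.1 b.succ :=
  dirDeriv_eq_of_quadratic (R := g.inversion / 2 * v.1 0 * v.1 a.succ)
    ((g.contDiff_space z₀ a).differentiable (by simp) p) fun t => by
      have hrot : ∑ b, g.rotation a b * (p.1 b.succ + t * v.1 b.succ - z₀ b.succ)
          = ∑ b, g.rotation a b * (p.1 b.succ - z₀ b.succ)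
            + t * ∑ b, g.rotation a b * v.1 b.succ := by
        rw [Finset.mul_sum, ← Finset.sum_add_distrib]
        exact Finset.sum_congr rfl fun b _ => by ring
      simp only [space, rate, Prod.fst_add, Prod.smul_fst, Pi.add_apply, Pi.smul_apply,
        smul_eq_mul, hrot]
      ring

lemma dirDeriv_phaseRate (v p : Base n) :
    dirDeriv v (g.phaseRate z₀) p
      = ∑ b, (g.inversion / 4 * (p.1 b.succ - z₀ b.succ) + g.boost b / 2) * v.1 b.succ :=
  dirDeriv_eq_of_quadratic (R := ∑ b : Fin n, g.inversion / 8 * v.1 b.succ ^ 2)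
    ((g.contDiff_phaseRate z₀).differentiable (by simp) p) fun t => by
      simp only [phaseRate, Prod.fst_add, Prod.smul_fst, Pi.add_apply, Pi.smul_apply, smul_eq_mul,
        Finset.mul_sum, add_assoc, ← Finset.sum_add_distrib]
      congr 1
      exact Finset.sum_congr rfl fun b _ => by ring

lemma dirDeriv_multiplier (v p : Base n) :
    dirDeriv v (g.multiplier z₀) p = Complex.I * (dirDeriv v (g.phaseRate z₀) p : ℝ)
      - n / 4 * (g.inversion * v.1 0 : ℝ) := by
  have hphase := (g.contDiff_phaseRate z₀).differentiable (by simp) p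
  have hrate := (g.contDiff_rate z₀).differentiable (by simp) p
  have hcast : ∀ {f : Base n → ℝ}, DifferentiableAt ℝ f p →
      DifferentiableAt ℝ (fun q => (f q : ℂ)) p := fun hf =>
    Complex.ofRealCLM.differentiableAt.comp p hf
  unfold multiplier
  rw [dirDeriv_sub ((hcast hphase).const_mul _) ((hcast hrate).const_mul _),
    dirDeriv_const_mul (hcast hphase), dirDeriv_const_mul (hcast hrate), ← g.dirDeriv_rate z₀]
  exact congrArg₂ (fun z w => Complex.I * z - n / 4 * w)
    (dirDeriv_clm_comp Complex.ofRealCLM hphase v) (dirDeriv_clm_comp Complex.ofRealCLM hrate v)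

lemma dirDeriv_vert_multiplier (c : ℂ) (p : Base n) : ∂ψ[c] (g.multiplier z₀) p = 0 := by
  simp [dirDeriv_multiplier, dirDeriv_phaseRate]

lemma dirDeriv_time_multiplier (p : Base n) :
    ∂ₜ (g.multiplier z₀) p = -(n / 4 * g.inversion) := by
  simp [dirDeriv_multiplier, dirDeriv_phaseRate]

lemma dirDeriv_space_multiplier (a : Fin n) :
    ∂ₓ[a] (g.multiplier z₀) = fun p => Complex.I *
      (g.inversion / 4 * (p.1 a.succ - z₀ a.succ) + g.boost a / 2 : ℝ) := by
  funext p
  simp [dirDeriv_multiplier, dirDeriv_phaseRate, Pi.single_apply]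

lemma dirDeriv_space_space_multiplier (a : Fin n) (p : Base n) :
    ∂ₓ[a] (∂ₓ[a] (g.multiplier z₀)) p = Complex.I * (g.inversion / 4) := by
  have hd : DifferentiableAt ℝ (∂ₓ[a] (g.multiplier z₀)) p :=
    differentiableAt_of_contDiffOn isOpen_univ
      (contDiffOn_dirDeriv isOpen_univ (g.contDiff_multiplier z₀).contDiffOn _) (Set.mem_univ p)
  refine dirDeriv_eq_of_affine hd fun t => ?_
  rw [dirDeriv_space_multiplier]
  simp only [Prod.smul_mk, smul_zero, Prod.fst_add, Pi.add_apply, Pi.smul_apply,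
    Pi.single_eq_same, smul_eq_mul, mul_one, Complex.ofReal_add, Complex.ofReal_mul,
    Complex.ofReal_div, Complex.ofReal_ofNat, Complex.ofReal_sub, Complex.real_smul]
  ring

lemma eta_field : eta (g.field z₀) = fun p => g.multiplier z₀ p * p.2 := rfl

lemma dirDeriv_vert_eta_field (c : ℂ) (p : Base n) :
    ∂ψ[c] (eta (g.field z₀)) p = c * g.multiplier z₀ p := by
  rw [eta_field, dirDeriv_mul_snd ((g.contDiff_multiplier z₀).differentiable (by simp) p),
    dirDeriv_vert_multiplier]
  ring

lemma zeta_field : zeta (g.field z₀) = g.multiplier z₀ :=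
  funext fun p => (g.dirDeriv_vert_eta_field z₀ 1 p).trans (one_mul _)

lemma xi_field_zero : xi (g.field z₀) 0 = g.tau z₀ := rfl

lemma xi_field_succ (a : Fin n) : xi (g.field z₀) a.succ = g.space z₀ a := rfl

lemma dirDeriv_space_space (a b : Fin n) (p : Base n) :
    ∂ₓ[b] (g.space z₀ a) p = (if a = b then g.rate z₀ p / 2 else 0) + g.rotation a b := by
  simp [dirDeriv_space, Pi.single_apply]

lemma potentialFreeEqns_field (M : Set (Base n)) : PotentialFreeEqns M (g.field z₀) where
  tau_space p _ a := by simp [xi_field_zero, dirDeriv_tau]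
  xi_vert p _ κ c := by
    refine Fin.cases ?_ (fun a => ?_) κ
    · simp [xi_field_zero, dirDeriv_tau]
    · simp [xi_field_succ, dirDeriv_space]
  killing p _ a b := by
    have hskew := g.rotation_add_rotation a b
    simp only [xi_field_zero, xi_field_succ, dirDeriv_space_space, dirDeriv_tau, Pi.single_eq_same,
      mul_one, eq_comm (a := b)]
    split_ifs <;> linarith
  eta_vert p _ c := by rw [dirDeriv_vert_eta_field, zeta_field]
  zeta_vert p _ c := by rw [zeta_field, dirDeriv_vert_multiplier]
  zeta_space p _ a := by
    rw [zeta_field, dirDeriv_space_multiplier, xi_field_succ, dirDeriv_space]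
    simp only [Complex.ofReal_add, Complex.ofReal_mul, Complex.ofReal_div, Complex.ofReal_ofNat,
      Complex.ofReal_sub, Pi.single_eq_same, mul_one, ne_eq, Fin.succ_ne_zero, not_false_eq_true,
      Pi.single_eq_of_ne, mul_zero, add_zero, Finset.sum_const_zero]
    ring

lemma potentialVar_powerS_field (hn : 1 ≤ n) (hΩ : IsDomainRho Ω) (hp : p ∈ dom Ω) :
    potentialVar (potential (powerS n)) (g.field z₀) p = 0 := by
  have hn' : (n : ℂ) ≠ 0 := by exact_mod_cast (by omega : n ≠ 0)
  have hre : (g.multiplier z₀ p).re = -(n / 4 * g.rate z₀ p) := by simp [multiplier]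
  rw [potentialVar, xi_field_zero, zeta_field, radial_powerS hΩ hp, hre, dirDeriv_tau]
  simp only [dirDeriv_coordVec_potential_powerS hΩ hp, smul_zero, Finset.sum_const_zero,
    Pi.single_eq_same, Complex.real_smul]
  push_cast
  field_simp
  ring

lemma classifyingSystem_field (hn : 1 ≤ n) (hΩ : IsDomainRho Ω) :
    ClassifyingSystem (dom Ω) (potential (powerS n)) (g.field z₀) where
  toPotentialFreeEqns := g.potentialFreeEqns_field z₀ _
  etaZero_eq_zero p _ := by rw [etaZero, zeta_field, eta_field, sub_self]
  classifying_eq_zero p hp := by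
    rw [classifying, g.potentialVar_powerS_field z₀ hn hΩ hp, zeta_field, dirDeriv_time_multiplier]
    simp only [dirDeriv_space_space_multiplier, Finset.sum_const, Finset.card_univ,
      Fintype.card_fin, nsmul_eq_mul]
    ring

end CriticalSymmetry

/-- The skew-symmetric matrix with given entries below the diagonal. -/
def skew (r : LowerPairs n → ℝ) (a b : Fin n) : ℝ :=
  if h : b < a then r ⟨a, ⟨b, h⟩⟩ else if h : a < b then -r ⟨b, ⟨a, h⟩⟩ else 0

lemma skew_add_skew (r : LowerPairs n → ℝ) (a b : Fin n) : skew r a b + skew r b a = 0 := by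
  rcases lt_trichotomy a b with hab | rfl | hab
  · simp [skew, hab, hab.not_gt]
  · simp [skew]
  · simp [skew, hab, hab.not_gt]

lemma lowerEntry_skew (r : LowerPairs n → ℝ) : lowerEntry (skew r) = r :=
  funext fun k => dif_pos k.2.2

namespace CriticalSymmetry

/-- The symmetry of the critical equation with prescribed jet data at its centre. -/
def ofJetData (d : JetData n) : CriticalSymmetry n where
  shift := d.1.1
  scaling := -(4 / n) * d.1.2.re
  boost := d.2.1
  inversion := d.2.2.1
  rotation := skew d.2.2.2
  rotation_add_rotation := skew_add_skew d.2.2.2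
  phase := d.1.2.im

lemma jetDataMap_coeffJet_field (g : CriticalSymmetry n) (p : Base n) :
    jetDataMap n (coeffJet (g.field p.1) p)
      = ((g.shift, Complex.I * g.phase - n / 4 * g.scaling), g.boost, g.inversion,
        lowerEntry g.rotation) := by
  have hτt : ∂ₜ (g.tau p.1) = g.rate p.1 := funext fun q => by simp [dirDeriv_tau]
  have hshift : (fun μ => xi (g.field p.1) μ p) = g.shift :=
    funext (Fin.cases (by simp [xi_field_zero, tau]) fun a => by simp [xi_field_succ, space])
  have hζ : zeta (g.field p.1) p = Complex.I * g.phase - n / 4 * g.scaling := by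
    simp [zeta_field, multiplier, phaseRate, rate]
  have hboost : (fun a : Fin n => ∂ₜ (xi (g.field p.1) a.succ) p) = g.boost :=
    funext fun a => by simp [xi_field_succ, dirDeriv_space]
  have hτtt : ∂ₜ (∂ₜ (xi (g.field p.1) 0)) p = g.inversion := by
    simp [xi_field_zero, hτt, dirDeriv_rate]
  have hrot : lowerEntry (fun a b => ∂ₓ[b] (xi (g.field p.1) a.succ) p) = lowerEntry g.rotation :=
    funext fun k => by
      have hne : k.1 ≠ k.2.castLE k.1.2.le := (show k.2.castLE k.1.2.le < k.1 from k.2.2).ne'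
      simp only [lowerEntry, xi_field_succ, dirDeriv_space_space, if_neg hne, zero_add]
  exact Prod.ext (Prod.ext hshift hζ) (Prod.ext hboost (Prod.ext hτtt hrot))

lemma jetDataMap_coeffJet_field_ofJetData (hn : 1 ≤ n) (d : JetData n) (p : Base n) :
    jetDataMap n (coeffJet ((ofJetData d).field p.1) p) = d := by
  have hn' : (n : ℂ) ≠ 0 := by exact_mod_cast (by omega : n ≠ 0)
  have hζ : Complex.I * (ofJetData d).phase - n / 4 * (ofJetData d).scaling = d.1.2 := by
    simp only [ofJetData]
    push_cast
    field_simp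
    linear_combination Complex.re_add_im d.1.2
  rw [jetDataMap_coeffJet_field, hζ]
  simp only [ofJetData, lowerEntry_skew]

end CriticalSymmetry

lemma indicator_field_mem_lieInvAlg (g : CriticalSymmetry n) (z₀ : Fin (n + 1) → ℝ) (hn : 1 ≤ n)
    (hΩ : IsDomainRho Ω) : (dom Ω).indicator (g.field z₀) ∈ lieInvAlg hΩ (powerS n) := by
  have hM := isOpen_dom hΩ.isOpen
  have hS := contDiffOn_powerS hΩ
  have hfield := (g.contDiff_field z₀).contDiffOn (s := dom Ω)
  have hind : Set.EqOn ((dom Ω).indicator (g.field z₀)) (g.field z₀) (dom Ω) :=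
    Set.eqOn_indicator
  refine ⟨hfield.congr hind, fun p hp => Set.indicator_of_notMem hp _, ?_⟩
  rw [invCriterion_iff_invariantOn hM (hfield.congr hind) (contDiffOn_potential hΩ hS)]
  intro p hp u U hU he
  rw [prolAction_congr hM hind hp]
  exact ((g.classifyingSystem_field z₀ hn hΩ).detEqns hΩ hS hfield).invariantOn hM hfield
    p hp u U hU he

lemma jetDataMap_comp_coeffJetMap_surjective (hn : 1 ≤ n) (hΩ : IsDomainRho Ω) {p₀ : Base n}
    (hp₀ : p₀ ∈ dom Ω) : Function.Surjective (jetDataMap n ∘ₗ coeffJetMap hΩ (powerS n) hp₀) :=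
  fun d => ⟨⟨_, indicator_field_mem_lieInvAlg (.ofJetData d) p₀.1 hn hΩ⟩,
    (congrArg (jetDataMap n) (coeffJet_congr (isOpen_dom hΩ.isOpen) Set.eqOn_indicator hp₀)).trans
      (CriticalSymmetry.jetDataMap_coeffJet_field_ofJetData hn d p₀)⟩

lemma finrank_lieInvAlg_powerS (hn : 1 ≤ n) (hΩ : IsDomainRho Ω) :
    Module.finrank ℝ (lieInvAlg hΩ (powerS n)) = n * (n + 3) / 2 + 4 := by
  obtain ⟨p₀, hp₀⟩ := nonempty_dom hΩ
  obtain ⟨hfin, hle⟩ := finite_and_finrank_lieInvAlg_le hn hΩ (isClassS_powerS hn hΩ)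
  refine hle.antisymm ?_
  rw [← finrank_jetData]
  exact LinearMap.finrank_le_finrank_of_surjective
    (jetDataMap_comp_coeffJetMap_surjective hn hΩ hp₀)

end CriticalPower

end NLS

end

theorem mainTheorem6 (n : ℕ) (hn : 1 ≤ n) (Ω : Set ((Fin (n + 1) → ℝ) × ℝ))
    (hΩ : NLS.IsDomainRho Ω) :
    (∀ S : (Fin (n + 1) → ℝ) × ℝ → ℂ, NLS.IsClassS Ω S →
      Module.Finite ℝ (NLS.lieInvAlg hΩ S) ∧
        Module.finrank ℝ (NLS.lieInvAlg hΩ S) ≤ n * (n + 3) / 2 + 4) ∧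
    NLS.IsClassS Ω (NLS.powerS n) ∧
    Module.finrank ℝ (NLS.lieInvAlg hΩ (NLS.powerS n)) = n * (n + 3) / 2 + 4 :=
  ⟨fun _ hS => NLS.finite_and_finrank_lieInvAlg_le hn hΩ hS, NLS.isClassS_powerS hn hΩ,
    NLS.finrank_lieInvAlg_powerS hn hΩ⟩
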